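/- Let $W=W^1+iW^2$ be a standard planar Brownian motion on $[0,\infty)$, i.e. $W^1$ and $W^2$ are independent standard one-dimensional Brownian motions started at $0$ with continuous paths, and set $W(t)=0$ for $t\le 0$. For $\tau>0$ and $p\in\mathbb{R}$ put $$f(p,\tau)=\int_{\mathbb{R}} W(p-z)\,\frac{1}{\sqrt{2\pi\tau}}\,e^{-z^2/(2\tau)}\,dz ,$$ the integral being taken for a fixed realisation of $W$; for fixed $\tau$, the curve $f(\cdot,\tau):\mathbb{R}\to\mathbb{C}$ is called a particle path. A singularity of a curve $\gamma:\mathbb{R}\to\mathbb{C}$ is a point $t_0$ with $\gamma'(t_0)=0$. A singularity $t_0$ is called a cusp singularity if $\gamma$ is real analytic in a neighbourhood of $t_0$ and there are a rotation (multiplication by some $c\in\mathbb{C}$ with $|c|=1$), real numbers $(a_i)_{i\ge2}$, $(b_i)_{i\ge3}$ with $a_2\ne0$, $b_3\ne0$, and $\delta>0$ such that for all $t\in[t_0-\delta,t_0+\delta]$ $$\operatorname{Re}\bigl(c(\gamma(t)-\gamma(t_0))\bigr)=\sum_{i=2}^{\infty}a_i(t-t_0)^i,\qquad \operatorname{Im}\bigl(c(\gamma(t)-\gamma(t_0))\bigr)=\sum_{i=3}^{\infty}b_i(t-t_0)^i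 .$$ Then, with probability one, for all $\tau_0>0$ and all $p_0>0$ simultaneously: if $p_0$ is a singularity of $f(\cdot,\tau_0)$, then $p_0$ is a cusp singularity of $f(\cdot,\tau_0)$. -/

import Mathlib

open MeasureTheory ProbabilityTheory
open scoped NNReal

/-- Standard planar (complex) Brownian motion: the real and imaginary parts are independent
standard one-dimensional Brownian motions started at `0`. -/
structure IsComplexBrownian {Ω : Type*} {mΩ : MeasurableSpace Ω} (W : ℝ≥0 → Ω → ℂ)
    (P : Measure Ω) : Prop where
  re : IsBrownianReal (fun t ω ↦ (W t ω).re) P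
  im : IsBrownianReal (fun t ω ↦ (W t ω).im) P
  indep : IndepFun (fun ω (t : ℝ≥0) ↦ (W t ω).re) (fun ω (t : ℝ≥0) ↦ (W t ω).im) P

/-- Extension of a path `w` on `[0, ∞)` to the real line by `0` on `(-∞, 0]`. -/
noncomputable def extendByZero (w : ℝ≥0 → ℂ) (s : ℝ) : ℂ :=
  if 0 < s then w s.toNNReal else 0

/-- `f(p, τ) = 𝔼 w(p - Z)` with `Z` centred Gaussian of variance `τ`, where the path `w` (a fixed
realisation of the Brownian motion) is extended by `0` to the negative half-line. For fixed `τ`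
the curve `f(·, τ)` is a particle path. -/
noncomputable def particlePath (w : ℝ≥0 → ℂ) (τ : ℝ≥0) (p : ℝ) : ℂ :=
  ∫ z, extendByZero w (p - z) ∂(gaussianReal 0 τ)

/-- A singularity of a curve: a point at which its velocity (equivalently its speed) vanishes. -/
def IsSingularity (γ : ℝ → ℂ) (t₀ : ℝ) : Prop :=
  HasDerivAt γ 0 t₀

/-- A cusp singularity: a singularity `t₀` near which `γ` is real analytic and such that, for some
rotation `c` about `γ t₀` (followed by the translation taking `γ t₀` to `0`), the coordinates of
the moved curve have, on some `[t₀ - δ, t₀ + δ]`, power series starting in degrees `2` and `3`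
respectively, with nonzero leading coefficients. -/
structure IsCuspSingularity (γ : ℝ → ℂ) (t₀ : ℝ) : Prop where
  singular : IsSingularity γ t₀
  analytic : AnalyticAt ℝ γ t₀
  expansion : ∃ (c : Circle) (a b : ℕ → ℝ) (δ : ℝ), 0 < δ ∧ a 2 ≠ 0 ∧ b 3 ≠ 0 ∧
    ∀ t ∈ Set.Icc (t₀ - δ) (t₀ + δ),
      HasSum (fun i : ℕ ↦ a (i + 2) * (t - t₀) ^ (i + 2)) ((c : ℂ) * (γ t - γ t₀)).re ∧
      HasSum (fun i : ℕ ↦ b (i + 3) * (t - t₀) ^ (i + 3)) ((c : ℂ) * (γ t - γ t₀)).im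

/-! Up to nonzero factors, the first three derivatives of a particle path in `p` are the Hermite
moments `M₁`, `M₂`, `M₃` of the Brownian path against a Gaussian weight. The path extends to an
entire function of `p`. At a singularity `M₁ = 0`, and rotating `M₂` to the positive real axis gives
a cusp as soon as `Im (conj M₂ * M₃) ≠ 0` (`isCuspSingularity_of_linearIndependent`).

It remains to exclude, almost surely and for all `(p, τ)` at once, that `M₁ = 0` while `M₂`, `M₃`
are real-linearly dependent. These are three real conditions on two real parameters, so generically
there is no solution. To make this precise, the path is written as a residual plus three complex
increments of `W`, each multiplied by a deterministic ramp. The increments are independent of the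
residual and have an absolutely continuous law on a six-dimensional real space
(`indepFun_complexResidual`, `map_complexIncrement_absolutelyContinuous`).

With the residual frozen, and where the moment matrix of the ramps is invertible, the increments are
determined by `(p, τ)` and the moments. Degenerate moments have the form `(0, s e^{iθ}, t e^{iθ})`,
so the bad increments lie in a differentiable image of a five-dimensional set, which is null
(`volume_exists_degeneracy_eq_zero`). Fubini (`ae_notMem_of_indepFun`) removes the freezing. For
each `(p, τ)` the matrix is invertible for some ramp length (`exists_rampMatrix_det_ne_zero`), so
countably many null events suffice. -/

open Filter Topology

/-! ### Exponential moments and their holomorphy. -/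

/-- Paths on the half-line which are integrable against `s ↦ e ^ (-s)`. -/
def ExpIntegrable (w : ℝ → ℂ) : Prop :=
  IntegrableOn (fun s ↦ w s * (Real.exp (-s) : ℂ)) (Set.Ioi 0)

/-- The moment `∫ w(s) s ^ k exp (a s - b s²) ds` over the half-line. -/
noncomputable def expMoment (w : ℝ → ℂ) (k : ℕ) (q : ℂ × ℂ) : ℂ :=
  ∫ s in Set.Ioi (0 : ℝ), w s * ((s : ℂ) ^ k * Complex.exp (q.1 * s - q.2 * (s : ℂ) ^ 2))

theorem exists_pow_mul_exp_le (k : ℕ) (A : ℝ) {B : ℝ} (hB : 0 < B) :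
    ∃ C, ∀ s : ℝ, 0 < s → s ^ k * Real.exp (A * s - B * s ^ 2) ≤ C := by
  -- The bound `s ^ k ≤ k! e ^ s` leaves the quadratic `(1 + A) s - B s²`, whose maximum is `(1 +
  -- A)² / (4 B)`.
  refine ⟨k.factorial * Real.exp ((1 + A) ^ 2 / (4 * B)), fun s hs ↦ ?_⟩
  have h1 : s ^ k ≤ k.factorial * Real.exp s := by
    have := Real.pow_div_factorial_le_exp s hs.le k
    rwa [div_le_iff₀' (by positivity)] at this
  calc s ^ k * Real.exp (A * s - B * s ^ 2)
      ≤ k.factorial * Real.exp s * Real.exp (A * s - B * s ^ 2) := by gcongr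
    _ = k.factorial * Real.exp (s + (A * s - B * s ^ 2)) := by rw [mul_assoc, ← Real.exp_add]
    _ ≤ _ := by
      gcongr
      rw [le_div_iff₀ (by positivity)]
      nlinarith [sq_nonneg (2 * B * s - (1 + A))]

theorem norm_kernel_le {q : ℂ × ℂ} {A B s : ℝ} (hA : ‖q.1‖ ≤ A) (hB : B ≤ q.2.re) (hs : 0 < s)
    (k : ℕ) : ‖(s : ℂ) ^ k * Complex.exp (q.1 * s - q.2 * (s : ℂ) ^ 2)‖ ≤
      s ^ k * Real.exp (A * s - B * s ^ 2) := by
  have h2 : ((s : ℂ) ^ 2) = ((s ^ 2 : ℝ) : ℂ) := by push_cast; ring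
  rw [norm_mul, norm_pow, Complex.norm_real, Real.norm_of_nonneg hs.le, Complex.norm_exp, h2,
    Complex.sub_re, Complex.re_mul_ofReal, Complex.re_mul_ofReal]
  have := (Complex.re_le_norm q.1).trans hA
  gcongr

theorem ExpIntegrable.aestronglyMeasurable {w : ℝ → ℂ} (hw : ExpIntegrable w) :
    AEStronglyMeasurable w (volume.restrict (Set.Ioi 0)) := by
  have : w = fun s ↦ (w s * (Real.exp (-s) : ℂ)) * (Real.exp s : ℂ) := by
    ext s
    rw [mul_assoc, ← Complex.ofReal_mul, ← Real.exp_add]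
    simp
  rw [this]
  exact hw.1.mul (by fun_prop)

theorem ExpIntegrable.bound {w : ℝ → ℂ} (hw : ExpIntegrable w) (k : ℕ) (A : ℝ) {B : ℝ}
    (hB : 0 < B) :
    IntegrableOn (fun s ↦ ‖w s‖ * (s ^ k * Real.exp (A * s - B * s ^ 2))) (Set.Ioi 0) := by
  -- Raising `A` to `A + 1` leaves a factor `e ^ (-s)`, the weight for which `w` is integrable.
  obtain ⟨C, hC⟩ := exists_pow_mul_exp_le k (A + 1) hB
  refine (hw.norm.mul_const C).mono' ?_ ?_
  · exact hw.aestronglyMeasurable.norm.mul (by fun_prop)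
  · filter_upwards [ae_restrict_mem measurableSet_Ioi] with s hs
    have hs : 0 < s := hs
    rw [Real.norm_of_nonneg (by positivity), norm_mul, mul_assoc, Complex.norm_real,
      Real.norm_of_nonneg (Real.exp_nonneg _)]
    refine mul_le_mul_of_nonneg_left ?_ (norm_nonneg _)
    calc s ^ k * Real.exp (A * s - B * s ^ 2)
        = Real.exp (-s) * (s ^ k * Real.exp ((A + 1) * s - B * s ^ 2)) := by
          rw [mul_left_comm, ← Real.exp_add]; ring_nf
      _ ≤ _ := by gcongr; exact hC s hs

theorem ExpIntegrable.integrable_kernel {w : ℝ → ℂ} (hw : ExpIntegrable w) (k : ℕ) {q : ℂ × ℂ}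
    (hq : 0 < q.2.re) :
    IntegrableOn (fun s : ℝ ↦ w s * ((s : ℂ) ^ k * Complex.exp (q.1 * s - q.2 * (s : ℂ) ^ 2)))
      (Set.Ioi 0) := by
  refine (hw.bound k ‖q.1‖ hq).mono' ?_ ?_
  · exact hw.aestronglyMeasurable.mul (by fun_prop)
  · filter_upwards [ae_restrict_mem measurableSet_Ioi] with s hs
    rw [norm_mul]
    gcongr
    exact norm_kernel_le le_rfl le_rfl hs k

/-- Joint holomorphy serves twice: it makes the path entire in `p`, and it makes the moments
differentiable in `(p, τ)` for the dimension count. -/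
theorem hasFDerivAt_expMoment {w : ℝ → ℂ} (hw : ExpIntegrable w) (k : ℕ) {q : ℂ × ℂ}
    (hq : 0 < q.2.re) :
    HasFDerivAt (expMoment w k)
      (expMoment w (k + 1) q • ContinuousLinearMap.fst ℂ ℂ ℂ
        - expMoment w (k + 2) q • ContinuousLinearMap.snd ℂ ℂ ℂ) q := by
  set K : ℕ → ℂ × ℂ → ℝ → ℂ := fun k q s ↦
    w s * ((s : ℂ) ^ k * Complex.exp (q.1 * s - q.2 * (s : ℂ) ^ 2)) with hK
  -- On this neighbourhood the linear coefficient is bounded above and the quadratic one below, so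
  -- one integrable function dominates all the derivatives.
  set U : Set (ℂ × ℂ) := {q' | ‖q'.1‖ < ‖q.1‖ + 1 ∧ q.2.re / 2 < q'.2.re} with hU
  have hUo : IsOpen U := by
    exact (isOpen_lt continuous_fst.norm continuous_const).inter (isOpen_lt continuous_const
      (Complex.continuous_re.comp continuous_snd))
  have hUq : U ∈ 𝓝 q := hUo.mem_nhds ⟨by linarith, by linarith⟩
  have key := hasFDerivAt_integral_of_dominated_of_fderiv_le (𝕜 := ℂ)
    (μ := volume.restrict (Set.Ioi (0 : ℝ))) (F := K k)
    (F' := fun q s ↦ K (k + 1) q s • ContinuousLinearMap.fst ℂ ℂ ℂ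
        - K (k + 2) q s • ContinuousLinearMap.snd ℂ ℂ ℂ)
    (bound := fun s ↦ ‖w s‖ * (s ^ (k + 1) * Real.exp ((‖q.1‖ + 1) * s - q.2.re / 2 * s ^ 2))
      + ‖w s‖ * (s ^ (k + 2) * Real.exp ((‖q.1‖ + 1) * s - q.2.re / 2 * s ^ 2)))
    hUq ?_ (hw.integrable_kernel k hq) ?_ ?_ ?_ ?_
  · rw [integral_sub ((hw.integrable_kernel (k + 1) hq).smul_const _)
      ((hw.integrable_kernel (k + 2) hq).smul_const _), integral_smul_const,
      integral_smul_const] at key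
    exact key
  · exact Eventually.of_forall fun q ↦ hw.aestronglyMeasurable.mul (by fun_prop)
  · have h1 := ((hw.integrable_kernel (k + 1) hq).smul_const
      (ContinuousLinearMap.fst ℂ ℂ ℂ)).aestronglyMeasurable
    exact h1.sub ((hw.integrable_kernel (k + 2) hq).smul_const
      (ContinuousLinearMap.snd ℂ ℂ ℂ)).aestronglyMeasurable
  · filter_upwards [ae_restrict_mem measurableSet_Ioi] with s hs q' hq'
    refine (norm_sub_le _ _).trans (add_le_add ?_ ?_)
    · refine (norm_smul_le _ _).trans ((mul_le_of_le_one_right (norm_nonneg _)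
        (ContinuousLinearMap.norm_fst_le ℂ ℂ ℂ)).trans ?_)
      rw [norm_mul]
      gcongr
      exact norm_kernel_le hq'.1.le hq'.2.le hs _
    · refine (norm_smul_le _ _).trans ((mul_le_of_le_one_right (norm_nonneg _)
        (ContinuousLinearMap.norm_snd_le ℂ ℂ ℂ)).trans ?_)
      rw [norm_mul]
      gcongr
      exact norm_kernel_le hq'.1.le hq'.2.le hs _
  · exact (hw.bound _ _ (by linarith)).add (hw.bound _ _ (by linarith))
  · refine Eventually.of_forall fun s q' _ ↦ ?_
    have h1 : HasFDerivAt (fun q : ℂ × ℂ ↦ q.1 * (s : ℂ) - q.2 * (s : ℂ) ^ 2)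
        ((s : ℂ) • ContinuousLinearMap.fst ℂ ℂ ℂ - ((s : ℂ) ^ 2) • ContinuousLinearMap.snd ℂ ℂ ℂ)
        q' := by
      exact (hasFDerivAt_fst.mul_const (s : ℂ)).sub (hasFDerivAt_snd.mul_const ((s : ℂ) ^ 2))
    refine ((h1.cexp.const_mul (w s * (s : ℂ) ^ k)).congr_fderiv ?_).congr_of_eventuallyEq ?_
    · ext <;> simp [hK] <;> ring
    · exact Eventually.of_forall fun x ↦ by simp only [hK]; ring

/-! ### Hermite moments and the derivatives of a particle path. -/

/-- The Hermite polynomials of variance `τ` in degrees at most three. -/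
def hermitePoly : ℕ → ℂ → ℂ → ℂ
  | 0, _, _ => 1
  | 1, _, x => x
  | 2, τ, x => x ^ 2 - τ
  | 3, τ, x => x ^ 3 - 3 * τ * x
  | _, _, _ => 0

/-- The Hermite moments of a path against `exp (p s / τ - s² / (2 τ))`, where `q = (p, τ)`. -/
noncomputable def hermiteMoment (w : ℝ → ℂ) (j : ℕ) (q : ℂ × ℂ) : ℂ :=
  ∫ s in Set.Ioi (0 : ℝ), w s * (hermitePoly j q.2 (s - q.1) *
    Complex.exp (q.1 / q.2 * s - (2 * q.2)⁻¹ * (s : ℂ) ^ 2))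

theorem inv_two_mul_re_pos {τ : ℝ} (hτ : 0 < τ) : 0 < ((2 * (τ : ℂ))⁻¹).re := by
  have : (2 * (τ : ℂ))⁻¹ = (((2 * τ)⁻¹ : ℝ) : ℂ) := by push_cast; ring
  rw [this, Complex.ofReal_re]
  positivity

section
variable {w : ℝ → ℂ} {q : ℂ × ℂ}

theorem hermiteMoment_zero :
    hermiteMoment w 0 q = expMoment w 0 (q.1 / q.2, (2 * q.2)⁻¹) := by
  simp [hermiteMoment, expMoment, hermitePoly]

theorem hermiteMoment_one (hw : ExpIntegrable w) (hq : 0 < ((2 * q.2)⁻¹).re) :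
    hermiteMoment w 1 q = expMoment w 1 (q.1 / q.2, (2 * q.2)⁻¹)
      - q.1 * expMoment w 0 (q.1 / q.2, (2 * q.2)⁻¹) := by
  have h (k : ℕ) := hw.integrable_kernel k (q := (q.1 / q.2, (2 * q.2)⁻¹)) hq
  simp only [IntegrableOn] at h
  simp only [hermiteMoment, expMoment, ← integral_const_mul]
  rw [← integral_sub (h 1) ((h 0).const_mul _)]
  congr 1 with s
  simp only [hermitePoly]
  ring

theorem hermiteMoment_two (hw : ExpIntegrable w) (hq : 0 < ((2 * q.2)⁻¹).re) :
    hermiteMoment w 2 q = expMoment w 2 (q.1 / q.2, (2 * q.2)⁻¹)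
      - 2 * q.1 * expMoment w 1 (q.1 / q.2, (2 * q.2)⁻¹)
      + (q.1 ^ 2 - q.2) * expMoment w 0 (q.1 / q.2, (2 * q.2)⁻¹) := by
  have h (k : ℕ) := hw.integrable_kernel k (q := (q.1 / q.2, (2 * q.2)⁻¹)) hq
  simp only [IntegrableOn] at h
  simp only [hermiteMoment, expMoment, ← integral_const_mul]
  have h21 := (h 2).sub ((h 1).const_mul (2 * q.1))
  rw [← integral_sub (h 2) ((h 1).const_mul _)]
  erw [← integral_add h21 ((h 0).const_mul _)]
  congr 1 with s
  simp only [hermitePoly, Pi.sub_apply]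
  ring

theorem hermiteMoment_three (hw : ExpIntegrable w) (hq : 0 < ((2 * q.2)⁻¹).re) :
    hermiteMoment w 3 q = expMoment w 3 (q.1 / q.2, (2 * q.2)⁻¹)
      - 3 * q.1 * expMoment w 2 (q.1 / q.2, (2 * q.2)⁻¹)
      + (3 * q.1 ^ 2 - 3 * q.2) * expMoment w 1 (q.1 / q.2, (2 * q.2)⁻¹)
      + (3 * q.2 * q.1 - q.1 ^ 3) * expMoment w 0 (q.1 / q.2, (2 * q.2)⁻¹) := by
  have h (k : ℕ) := hw.integrable_kernel k (q := (q.1 / q.2, (2 * q.2)⁻¹)) hq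
  simp only [IntegrableOn] at h
  simp only [hermiteMoment, expMoment, ← integral_const_mul]
  have h32 := (h 3).sub ((h 2).const_mul (3 * q.1))
  have h31 := h32.add ((h 1).const_mul (3 * q.1 ^ 2 - 3 * q.2))
  rw [← integral_sub (h 3) ((h 2).const_mul _)]
  erw [← integral_add h32 ((h 1).const_mul _), ← integral_add h31 ((h 0).const_mul _)]
  congr 1 with s
  simp only [hermitePoly, Pi.sub_apply, Pi.add_apply]
  ring

theorem integrable_hermite_kernel (hw : ExpIntegrable w) (hq : 0 < ((2 * q.2)⁻¹).re) (j : ℕ) :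
    IntegrableOn (fun s : ℝ ↦ w s * (hermitePoly j q.2 (s - q.1) *
      Complex.exp (q.1 / q.2 * s - (2 * q.2)⁻¹ * (s : ℂ) ^ 2))) (Set.Ioi 0) := by
  have h (k : ℕ) := hw.integrable_kernel k (q := (q.1 / q.2, (2 * q.2)⁻¹)) hq
  simp only [IntegrableOn] at h ⊢
  match j with
  | 0 => exact (h 0).congr (.of_forall fun s ↦ by simp [hermitePoly])
  | 1 =>
    exact ((h 1).sub ((h 0).const_mul q.1)).congr
      (.of_forall fun s ↦ by simp only [hermitePoly, Pi.sub_apply]; ring)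
  | 2 =>
    exact (((h 2).sub ((h 1).const_mul (2 * q.1))).add ((h 0).const_mul (q.1 ^ 2 - q.2))).congr
      (.of_forall fun s ↦ by simp only [hermitePoly, Pi.sub_apply, Pi.add_apply]; ring)
  | 3 =>
    exact ((((h 3).sub ((h 2).const_mul (3 * q.1))).add
      ((h 1).const_mul (3 * q.1 ^ 2 - 3 * q.2))).add ((h 0).const_mul (3 * q.2 * q.1 - q.1 ^ 3))).congr
      (.of_forall fun s ↦ by simp only [hermitePoly, Pi.sub_apply, Pi.add_apply]; ring)
  | _ + 4 => simp [hermitePoly]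

end

/-- The integral against the Gaussian kernel of variance `τ`, extended to complex positions. -/
noncomputable def heatMoment (w : ℝ → ℂ) (τ : ℝ) (j : ℕ) (p : ℂ) : ℂ :=
  Complex.exp (-(2 * (τ : ℂ))⁻¹ * p ^ 2) * hermiteMoment w j (p, τ)

theorem hasDerivAt_expMoment_div {w : ℝ → ℂ} (hw : ExpIntegrable w) {τ : ℝ} (hτ : 0 < τ) (k : ℕ)
    (p : ℂ) : HasDerivAt (fun p : ℂ ↦ expMoment w k (p / τ, (2 * (τ : ℂ))⁻¹))
      (expMoment w (k + 1) (p / τ, (2 * (τ : ℂ))⁻¹) / τ) p := by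
  have h1 : HasDerivAt (fun p : ℂ ↦ (p / τ, (2 * (τ : ℂ))⁻¹)) (1 / (τ : ℂ), 0) p :=
    ((hasDerivAt_id p).div_const _).prodMk (hasDerivAt_const _ _)
  have h2 := (hasFDerivAt_expMoment hw k (q := (p / τ, (2 * (τ : ℂ))⁻¹))
    (inv_two_mul_re_pos hτ)).comp_hasDerivAt p h1
  refine h2.congr_deriv ?_
  simp
  ring

/-- With its exponential prefactor the kernel is `He_j(s - p) exp (-(s - p)² / (2 τ))`, and
differentiation in `p` raises the Hermite degree by one and divides by `τ`. The bound on `j`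
reflects that `hermitePoly` is set to zero above degree three. -/
theorem hasDerivAt_heatMoment {w : ℝ → ℂ} (hw : ExpIntegrable w) {τ : ℝ} (hτ : 0 < τ) {j : ℕ}
    (hj : j < 3) (p : ℂ) :
    HasDerivAt (heatMoment w τ j) (heatMoment w τ (j + 1) p / τ) p := by
  have hτ' : (τ : ℂ) ≠ 0 := by exact_mod_cast hτ.ne'
  have hq := inv_two_mul_re_pos hτ
  have hE : HasDerivAt (fun p : ℂ ↦ Complex.exp (-(2 * (τ : ℂ))⁻¹ * p ^ 2))
      (Complex.exp (-(2 * (τ : ℂ))⁻¹ * p ^ 2) * (-(2 * (τ : ℂ))⁻¹ * (2 * p))) p := by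
    simpa using ((hasDerivAt_pow 2 p).const_mul (-(2 * (τ : ℂ))⁻¹)).cexp
  have hH (k : ℕ) := hasDerivAt_expMoment_div hw hτ k p
  have hp := hasDerivAt_id p
  have h2 (a : ℂ) : (2 * a)⁻¹ = a⁻¹ / 2 := by rw [mul_inv]; ring
  unfold heatMoment
  interval_cases j
  · simp only [hermiteMoment_zero, hermiteMoment_one hw (q := (_, (τ : ℂ))) hq, zero_add]
    refine (hE.mul (hH 0)).congr_deriv ?_
    field_simp
    ring
  · simp only [hermiteMoment_two hw (q := (_, (τ : ℂ))) hq,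
      hermiteMoment_one hw (q := (_, (τ : ℂ))) hq, Nat.reduceAdd]
    refine (hE.mul ((hH 1).sub (hp.mul (hH 0)))).congr_deriv ?_
    simp only [id, Pi.sub_apply, Pi.mul_apply, Nat.reduceAdd]
    field_simp
    ring
  · simp only [hermiteMoment_two hw (q := (_, (τ : ℂ))) hq,
      hermiteMoment_three hw (q := (_, (τ : ℂ))) hq, Nat.reduceAdd]
    refine (hE.mul (((hH 2).sub ((hp.const_mul 2).mul (hH 1))).add
      (((hp.pow 2).sub_const (τ : ℂ)).mul (hH 0)))).congr_deriv ?_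
    simp only [id, Pi.sub_apply, Pi.mul_apply, Pi.add_apply, Pi.pow_apply, Nat.reduceAdd]
    field_simp
    ring

theorem differentiableAt_hermiteMoment {w : ℝ → ℂ} (hw : ExpIntegrable w) (j : ℕ) {q : ℝ × ℝ}
    (hq : 0 < q.2) :
    DifferentiableAt ℝ (fun q : ℝ × ℝ ↦ hermiteMoment w j (q.1, q.2)) q := by
  set c : ℝ × ℝ → ℂ × ℂ := fun q ↦ ((q.1 : ℂ) / q.2, (2 * (q.2 : ℂ))⁻¹)
  have hτ' : (q.2 : ℂ) ≠ 0 := by exact_mod_cast hq.ne'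
  have h1 : DifferentiableAt ℝ (fun q : ℝ × ℝ ↦ (q.1 : ℂ)) q :=
    Complex.ofRealCLM.differentiableAt.comp q differentiableAt_fst
  have h2 : DifferentiableAt ℝ (fun q : ℝ × ℝ ↦ (q.2 : ℂ)) q :=
    Complex.ofRealCLM.differentiableAt.comp q differentiableAt_snd
  have hc : DifferentiableAt ℝ c q := by
    have h3 : DifferentiableAt ℝ (fun q : ℝ × ℝ ↦ (q.2 : ℂ)⁻¹) q := h2.inv hτ'
    simp only [c, div_eq_mul_inv, mul_inv]
    exact (h1.mul h3).prodMk (h3.const_mul _)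
  have hH (k : ℕ) : DifferentiableAt ℝ (fun q : ℝ × ℝ ↦ expMoment w k (c q)) q :=
    ((hasFDerivAt_expMoment hw k (inv_two_mul_re_pos hq)).restrictScalars
      ℝ).differentiableAt.comp (f := c) q hc
  have hev : ∀ᶠ q' : ℝ × ℝ in 𝓝 q, 0 < ((2 * (q'.2 : ℂ))⁻¹).re := by
    filter_upwards [(isOpen_lt continuous_const continuous_snd).mem_nhds hq] with q' h
    exact inv_two_mul_re_pos h
  match j with
  | 0 => simpa only [hermiteMoment_zero] using hH 0
  | 1 =>
    refine ((hH 1).sub (h1.mul (hH 0))).congr_of_eventuallyEq ?_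
    filter_upwards [hev] with q' h using hermiteMoment_one hw (q := (_, (_ : ℂ))) h
  | 2 =>
    refine (((hH 2).sub ((h1.const_mul 2).mul (hH 1))).add
      (((h1.pow 2).sub h2).mul (hH 0))).congr_of_eventuallyEq ?_
    filter_upwards [hev] with q' h using hermiteMoment_two hw (q := (_, (_ : ℂ))) h
  | 3 =>
    refine ((((hH 3).sub ((h1.const_mul 3).mul (hH 2))).add
      ((((h1.pow 2).const_mul 3).sub (h2.const_mul 3)).mul (hH 1))).add
      ((((h2.const_mul 3).mul h1).sub (h1.pow 3)).mul (hH 0))).congr_of_eventuallyEq ?_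
    filter_upwards [hev] with q' h using hermiteMoment_three hw (q := (_, (_ : ℂ))) h
  | _ + 4 => simp [hermiteMoment, hermitePoly]

/-- Substitute `s = p - z` and expand the square in the Gaussian density; the part depending on `p`
alone is the prefactor of `heatMoment`. -/
theorem particlePath_eq_heatMoment (w : ℝ≥0 → ℂ) {τ : ℝ≥0} (hτ : 0 < τ) (p : ℝ) :
    particlePath w τ p =
      (√(2 * Real.pi * τ))⁻¹ * heatMoment (fun s ↦ w s.toNNReal) τ 0 p := by
  have hτ' : (τ : ℂ) ≠ 0 := by exact_mod_cast hτ.ne'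
  rw [particlePath, integral_gaussianReal_eq_integral_smul hτ.ne', heatMoment, hermiteMoment,
    ← integral_sub_left_eq_self _ volume p, ← integral_indicator measurableSet_Ioi,
    ← integral_const_mul, ← integral_const_mul]
  congr 1 with s
  by_cases hs : 0 < s
  · rw [Set.indicator_of_mem (show s ∈ Set.Ioi 0 from hs), sub_sub_cancel, extendByZero, if_pos hs]
    simp only [gaussianPDFReal, hermitePoly, Complex.real_smul, Complex.ofReal_mul,
      Complex.ofReal_exp]
    have : Complex.exp (-(2 * (τ : ℂ))⁻¹ * p ^ 2) *
        Complex.exp ((p : ℂ) / (τ : ℂ) * s - (2 * (τ : ℂ))⁻¹ * (s : ℂ) ^ 2) =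
        Complex.exp ((-(p - s - 0) ^ 2 / (2 * τ) : ℝ) : ℂ) := by
      rw [← Complex.exp_add]
      congr 1
      push_cast
      field_simp
      ring
    rw [← this]
    push_cast
    ring
  · rw [Set.indicator_of_notMem (show s ∉ Set.Ioi 0 from hs), sub_sub_cancel, extendByZero, if_neg hs]
    simp

/-! ### From nondegenerate moments to a cusp. -/

section cusp

variable {w : ℝ≥0 → ℂ} {τ : ℝ≥0} {p : ℝ}

theorem hasDerivAt_particlePath (hw : ExpIntegrable (fun s ↦ w s.toNNReal)) (hτ : 0 < τ) :
    HasDerivAt (particlePath w τ) ((√(2 * Real.pi * τ))⁻¹ *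
      (heatMoment (fun s ↦ w s.toNNReal) τ 1 p / τ)) p := by
  have := ((hasDerivAt_heatMoment hw (j := 0) (show (0 : ℝ) < τ from hτ) (by norm_num)
    (p : ℂ)).const_mul (((√(2 * Real.pi * τ))⁻¹ : ℝ) : ℂ)).comp_ofReal
  refine this.congr_of_eventuallyEq (.of_forall fun p ↦ ?_)
  exact particlePath_eq_heatMoment w hτ p

theorem IsSingularity.hermiteMoment_one_eq_zero (hw : ExpIntegrable (fun s ↦ w s.toNNReal))
    (hτ : 0 < τ) (h : IsSingularity (particlePath w τ) p) :
    hermiteMoment (fun s ↦ w s.toNNReal) 1 (p, ((τ : ℝ) : ℂ)) = 0 := by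
  have h1 := (hasDerivAt_particlePath hw hτ).unique h
  simpa [heatMoment, Real.pi_ne_zero, Real.sqrt_eq_zero', not_le.2 Real.pi_pos, hτ.ne', Complex.exp_ne_zero] using h1

theorem exists_circle_mul_eq_norm {z : ℂ} (hz : z ≠ 0) : ∃ (c : Circle) (d : ℂ), (c : ℂ) = d ∧
    d * z = ‖z‖ ∧ d = starRingEnd ℂ z / ‖z‖ := by
  have hz' : (‖z‖ : ℂ) ≠ 0 := by simpa using hz
  refine ⟨⟨starRingEnd ℂ z / ‖z‖, ?_⟩, _, rfl, ?_, rfl⟩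
  · simp [Submonoid.unitSphere, hz]
  · rw [div_mul_eq_mul_div, div_eq_iff hz', mul_comm, Complex.mul_conj, Complex.normSq_eq_norm_sq]
    push_cast; ring

theorem isCuspSingularity_of_linearIndependent (hw : ExpIntegrable (fun s ↦ w s.toNNReal))
    (hτ : 0 < τ) (h : IsSingularity (particlePath w τ) p)
    (h23 : (starRingEnd ℂ (hermiteMoment (fun s ↦ w s.toNNReal) 2 (p, ((τ : ℝ) : ℂ))) *
      hermiteMoment (fun s ↦ w s.toNNReal) 3 (p, ((τ : ℝ) : ℂ))).im ≠ 0) :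
    IsCuspSingularity (particlePath w τ) p := by
  set v : ℝ → ℂ := fun s ↦ w s.toNNReal with hv
  have hτ0 : (0 : ℝ) < τ := hτ
  have hτ' : (τ : ℂ) ≠ 0 := by exact_mod_cast hτ.ne'
  have hC : 0 < √(2 * Real.pi * τ) := by positivity
  set C : ℝ := (√(2 * Real.pi * τ))⁻¹ with hCdef
  set g : ℂ → ℂ := fun z ↦ C * heatMoment v τ 0 z with hg
  have hgp (t : ℝ) : particlePath w τ t = g t := by
    rw [particlePath_eq_heatMoment w hτ, hg, hCdef]
  have hd0 (z : ℂ) : HasDerivAt g (C * (heatMoment v τ 1 z / τ)) z :=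
    (hasDerivAt_heatMoment hw hτ0 (by norm_num) z).const_mul _
  have hd1 (z : ℂ) := ((hasDerivAt_heatMoment hw hτ0 (j := 1) (by norm_num)
    z).div_const (τ : ℂ)).const_mul (C : ℂ)
  have hd2 (z : ℂ) := (((hasDerivAt_heatMoment hw hτ0 (j := 2) (by norm_num)
    z).div_const (τ : ℂ)).div_const (τ : ℂ)).const_mul (C : ℂ)
  have hdiff : Differentiable ℂ g := fun z ↦ (hd0 z).differentiableAt
  have e1 : iteratedDeriv 1 g = fun z ↦ C * (heatMoment v τ 1 z / τ) := by
    rw [iteratedDeriv_one]; exact funext fun z ↦ (hd0 z).deriv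
  have e2 : iteratedDeriv 2 g = fun z ↦ C * (heatMoment v τ 2 z / τ / τ) := by
    rw [iteratedDeriv_succ, e1]; exact funext fun z ↦ (hd1 z).deriv
  have e3 : iteratedDeriv 3 g = fun z ↦ C * (heatMoment v τ 3 z / τ / τ / τ) := by
    rw [iteratedDeriv_succ, e2]; exact funext fun z ↦ (hd2 z).deriv
  have hM1 := h.hermiteMoment_one_eq_zero hw hτ
  set M2 := hermiteMoment v 2 (p, ((τ : ℝ) : ℂ)) with hM2
  set M3 := hermiteMoment v 3 (p, ((τ : ℝ) : ℂ)) with hM3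
  have hM20 : M2 ≠ 0 := by rintro h0; simp [h0] at h23
  -- The rotation is `conj M2 / ‖M2‖`: it makes the quadratic coefficient positive, and the
  -- imaginary part of the cubic one becomes a positive multiple of `Im (conj M2 * M3)`.
  obtain ⟨c, d, hcd, hc, hc'⟩ := exists_circle_mul_eq_norm hM20
  set r : ℝ := Real.exp (-(2 * (τ : ℝ))⁻¹ * p ^ 2) with hr
  have hr' : Complex.exp (-(2 * (τ : ℂ))⁻¹ * (p : ℂ) ^ 2) = r := by rw [hr]; push_cast; rfl
  have hr0 : 0 < r := Real.exp_pos _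
  set α : ℕ → ℂ := fun n ↦ (n.factorial : ℂ)⁻¹ * iteratedDeriv n g p with hα
  have α1 : α 1 = 0 := by
    simp only [hα, e1, heatMoment]
    rw [hM1]; simp
  have α2 : d * α 2 = ((2⁻¹ * C * r / τ ^ 2 * ‖M2‖ : ℝ) : ℂ) := by
    simp only [hα, e2, heatMoment]
    rw [← hM2, hr']
    push_cast
    rw [← hc]
    norm_num [Nat.factorial]
    ring
  have α3 : d * α 3 = ((6⁻¹ * C * r / τ ^ 3 / ‖M2‖ : ℝ) : ℂ) * (starRingEnd ℂ M2 * M3) := by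
    simp only [hα, e3, heatMoment]
    rw [← hM3, hr', hc']
    push_cast
    norm_num [Nat.factorial]
    ring
  have hsum (t : ℝ) : HasSum (fun n ↦ d * α (n + 2) * ((t - p : ℝ) : ℂ) ^ (n + 2))
      (d * (particlePath w τ t - particlePath w τ p)) := by
    have h1 := (Complex.hasSum_taylorSeries_of_entire hdiff (p : ℂ) (t : ℂ))
    -- Removing the constant term gives the displacement from the singular point; removing the
    -- linear term changes nothing since `α 1 = 0`.
    have h2 := ((hasSum_nat_add_iff' 2).2 h1).mul_left d
    have hval : d * (particlePath w τ t - particlePath w τ p) = d * (g t -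
        ∑ i ∈ Finset.range 2, ((i.factorial : ℂ)⁻¹ • ((t : ℂ) - p) ^ i • iteratedDeriv i g p)) := by
      have := α1
      simp only [hα] at this
      rw [Finset.sum_range_succ, Finset.sum_range_one, hgp, hgp]
      simp only [Nat.factorial_one, Nat.cast_one, inv_one, one_mul] at this
      simp [this]
    have hfun : (fun n ↦ d * α (n + 2) * ((t - p : ℝ) : ℂ) ^ (n + 2)) = fun n ↦ d *
        (((n + 2).factorial : ℂ)⁻¹ • ((t : ℂ) - p) ^ (n + 2) • iteratedDeriv (n + 2) g p) := by
      ext n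
      simp only [hα, smul_eq_mul]
      push_cast
      ring
    rw [hval, hfun]
    exact h2
  have hre (z : ℂ) (x : ℝ) (n : ℕ) : (z * ((x : ℂ)) ^ n).re = z.re * x ^ n := by
    rw [← Complex.ofReal_pow, Complex.re_mul_ofReal]
  have him (z : ℂ) (x : ℝ) (n : ℕ) : (z * ((x : ℂ)) ^ n).im = z.im * x ^ n := by
    rw [← Complex.ofReal_pow, Complex.im_mul_ofReal]
  refine ⟨h, ?_, c, fun n ↦ (d * α n).re, fun n ↦ (d * α n).im, 1, one_pos, ?_, ?_,
    fun t _ ↦ ⟨?_, ?_⟩⟩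
  · have : particlePath w τ = g ∘ (fun t : ℝ ↦ (t : ℂ)) := funext hgp
    rw [this]
    refine AnalyticAt.comp (𝕜 := ℝ) ?_ ?_
    · exact (hdiff.analyticAt _).restrictScalars
    · exact Complex.ofRealCLM.analyticAt _
  · simp only
    rw [α2, Complex.ofReal_re]
    have : 0 < ‖M2‖ := norm_pos_iff.2 hM20
    have : 0 < C := inv_pos.2 hC
    positivity
  · simp only
    rw [α3, Complex.im_ofReal_mul]
    have : 0 < ‖M2‖ := norm_pos_iff.2 hM20
    have : 0 < C := inv_pos.2 hC
    exact mul_ne_zero (by positivity) h23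
  · rw [hcd]
    have h2 := Complex.hasSum_re (hsum t)
    simp only [hre] at h2
    exact h2
  · rw [hcd]
    have h2 := Complex.hasSum_im (hsum t)
    -- The imaginary series starts one degree later because the rotated quadratic coefficient is
    -- real.
    have h3 := (hasSum_nat_add_iff' 1).2 h2
    simp only [him, Finset.sum_range_one, zero_add, α2, Complex.ofReal_im, zero_mul,
      sub_zero] at h3
    exact h3

end cusp

/-! ### Images of lower-dimensional spaces are null. -/

/-- A differentiable map into a space of larger dimension has an image of measure zero. -/
theorem addHaar_image_eq_zero_of_finrank_lt {G E : Type*} [NormedAddCommGroup G] [NormedSpace ℝ G]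
    [FiniteDimensional ℝ G] [NormedAddCommGroup E] [NormedSpace ℝ E] [FiniteDimensional ℝ E]
    [MeasurableSpace E] [BorelSpace E] (μ : Measure E) [μ.IsAddHaarMeasure]
    (hdim : Module.finrank ℝ G < Module.finrank ℝ E) {f : G → E} {s : Set G}
    (hf : ∀ x ∈ s, DifferentiableAt ℝ f x) : μ (f '' s) = 0 := by
  obtain ⟨i, hi⟩ : ∃ i : G →ₗ[ℝ] E, Function.Injective i := by
    refine Module.Free.exists_linearMap_injective_of_lift_rank_lt ?_
    rw [← Module.finrank_eq_rank, ← Module.finrank_eq_rank, Cardinal.lift_natCast,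
      Cardinal.lift_natCast]
    exact_mod_cast hdim
  obtain ⟨L, hL⟩ := i.exists_leftInverse_of_injective (LinearMap.ker_eq_bot.2 hi)
  have hLi (x : G) : L (i x) = x := LinearMap.congr_fun hL x
  set L' : E →L[ℝ] G := L.toContinuousLinearMap with hL'
  -- Precomposing with a linear surjection `E → G` gives a self-map of `E` with the same image. Its
  -- derivative factors through `G`, so its determinant vanishes and the zero-determinant case of
  -- Sard's theorem applies.
  have himage : f '' s = (f ∘ L') '' (L' ⁻¹' s) := by
    rw [Set.image_comp, Set.image_preimage_eq]
    exact fun x ↦ ⟨i x, hLi x⟩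
  rw [himage]
  refine addHaar_image_eq_zero_of_det_fderivWithin_eq_zero μ
    (f' := fun x ↦ (fderiv ℝ f (L' x)).comp L') (fun x hx ↦ ?_) (fun x hx ↦ ?_)
  · exact ((hf _ hx).hasFDerivAt.comp x L'.hasFDerivAt).hasFDerivWithinAt
  · by_contra hdet
    have hinj : Function.Injective (((fderiv ℝ f (L' x)).comp L' : E →L[ℝ] E) : E →ₗ[ℝ] E) := by
      rw [← LinearMap.ker_eq_bot, ← LinearMap.isUnit_iff_ker_eq_bot,
        LinearMap.isUnit_iff_isUnit_det]
      exact isUnit_iff_ne_zero.2 hdet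
    have hLinj : Function.Injective L := fun a b hab ↦ hinj (by
      simp only [ContinuousLinearMap.coe_coe, ContinuousLinearMap.comp_apply]
      exact congrArg _ hab)
    exact absurd (LinearMap.finrank_le_finrank_of_injective hLinj) (not_le.2 hdim)

theorem differentiableAt_det_fin_three {G : Type*} [NormedAddCommGroup G] [NormedSpace ℝ G]
    {A : G → Matrix (Fin 3) (Fin 3) ℂ} {x : G}
    (hA : ∀ i j, DifferentiableAt ℝ (fun x ↦ A x i j) x) :
    DifferentiableAt ℝ (fun x ↦ (A x).det) x := by
  simp only [Matrix.det_fin_three]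
  fun_prop

theorem differentiableAt_inv_fin_three {G : Type*} [NormedAddCommGroup G] [NormedSpace ℝ G]
    {A : G → Matrix (Fin 3) (Fin 3) ℂ} {x : G}
    (hA : ∀ i j, DifferentiableAt ℝ (fun x ↦ A x i j) x) (hx : (A x).det ≠ 0) (i j : Fin 3) :
    DifferentiableAt ℝ (fun x ↦ (A x)⁻¹ i j) x := by
  simp only [Matrix.inv_def, Ring.inverse_eq_inv', Matrix.smul_apply, Matrix.adjugate_apply,
    smul_eq_mul]
  refine DifferentiableAt.fun_mul ((differentiableAt_det_fin_three hA).inv hx)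
    (differentiableAt_det_fin_three fun k l ↦ ?_)
  simp only [Matrix.updateRow_apply]
  split_ifs
  · exact differentiableAt_const _
  · exact hA k l

/-! ### Ramps and the invertibility of their moment matrix. -/

/-- The integral up to time `t` of the normalized indicator of `[a, b]`. -/
noncomputable def ramp (a b t : ℝ) : ℝ := (min t b - min t a) / (b - a)

theorem continuous_ramp (a b : ℝ) : Continuous (ramp a b) := by
  unfold ramp; fun_prop

theorem ramp_nonneg {a b : ℝ} (hab : a < b) (t : ℝ) : 0 ≤ ramp a b t := by
  refine div_nonneg (sub_nonneg.2 ?_) (sub_nonneg.2 hab.le)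
  exact min_le_min_left _ hab.le

theorem ramp_le_one {a b : ℝ} (hab : a < b) (t : ℝ) : ramp a b t ≤ 1 := by
  rw [ramp, div_le_one (sub_pos.2 hab)]
  rcases le_total t a with h | h <;> rcases le_total t b with h' | h' <;> simp [*] <;> linarith

theorem norm_ramp_le_one {a b : ℝ} (hab : a < b) (t : ℝ) : ‖(ramp a b t : ℂ)‖ ≤ 1 := by
  rw [Complex.norm_real, Real.norm_of_nonneg (ramp_nonneg hab t)]
  exact ramp_le_one hab t

theorem expIntegrable_of_norm_le_one {w : ℝ → ℂ} (hw : AEStronglyMeasurable w)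
    (h : ∀ t, ‖w t‖ ≤ 1) : ExpIntegrable w := by
  refine (integrableOn_exp_neg_Ioi 0).mono' (hw.restrict.mul (by fun_prop))
    (.of_forall fun s ↦ ?_)
  rw [norm_mul, Complex.norm_real, Real.norm_of_nonneg (Real.exp_nonneg _)]
  exact mul_le_of_le_one_left (Real.exp_nonneg _) (h s)

theorem expIntegrable_ramp {a b : ℝ} (hab : a < b) : ExpIntegrable (fun s ↦ ramp a b s) :=
  expIntegrable_of_norm_le_one
    (Complex.continuous_ofReal.comp (continuous_ramp a b)).aestronglyMeasurable
    (norm_ramp_le_one hab)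

theorem tendsto_ramp (a s : ℝ) :
    Tendsto (fun n : ℕ ↦ (ramp a (a + 1 / ((n : ℝ) + 1)) s : ℂ)) atTop
      (𝓝 ((Set.Ioi a).indicator (fun _ ↦ 1) s)) := by
  refine tendsto_const_nhds.congr' ?_
  by_cases hs : s ∈ Set.Ioi a
  · have hs' : 0 < s - a := sub_pos.2 hs
    filter_upwards [(tendsto_one_div_add_atTop_nhds_zero_nat (𝕜 := ℝ)).eventually_lt_const hs']
      with n hn
    have hn0 : 0 < 1 / ((n : ℝ) + 1) := by positivity
    simp only [Set.indicator_of_mem hs, ramp]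
    rw [min_eq_right (by linarith), min_eq_right (le_of_lt hs),
      div_self (by simpa using hn0.ne')]
    simp
  · refine .of_forall fun n ↦ ?_
    have hn0 : 0 < 1 / ((n : ℝ) + 1) := by positivity
    have hs' : s ≤ a := not_lt.1 hs
    simp only [Set.indicator_of_notMem hs, ramp]
    rw [min_eq_left (by linarith), min_eq_left hs']
    simp

/-- This is the Rodrigues relation: the kernel of degree `j + 1` has an explicit primitive in `s`,
so its integrals over half-lines can be evaluated. -/
theorem hasDerivAt_hermite_kernel {τ : ℂ} (hτ : τ ≠ 0) (p : ℂ) {j : ℕ} (hj : j < 3) (s : ℝ) :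
    HasDerivAt (fun s : ℝ ↦ -τ * (hermitePoly j τ (s - p) *
        Complex.exp (p / τ * s - (2 * τ)⁻¹ * (s : ℂ) ^ 2)))
      (hermitePoly (j + 1) τ (s - p) *
        Complex.exp (p / τ * s - (2 * τ)⁻¹ * (s : ℂ) ^ 2)) s := by
  have hs : HasDerivAt (fun s : ℝ ↦ (s : ℂ)) 1 s := Complex.ofRealCLM.hasDerivAt
  have hE := (((hs.const_mul (p / τ)).sub ((hs.pow 2).const_mul ((2 * τ)⁻¹))).cexp)
  have hx := hs.sub_const p
  simp only [Pi.sub_apply, Pi.pow_apply] at hE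
  interval_cases j
  · refine ((hE.const_mul (-τ))).congr_of_eventuallyEq (.of_forall fun s ↦ ?_) |>.congr_deriv ?_
    · simp [hermitePoly]
    · simp only [hermitePoly]; field_simp; ring
  · refine ((hx.mul hE).const_mul (-τ)).congr_deriv ?_
    simp only [hermitePoly]; field_simp; ring
  · refine ((((hx.pow 2).sub_const τ).mul hE).const_mul (-τ)).congr_deriv ?_
    simp only [hermitePoly, Pi.pow_apply]; field_simp; ring

theorem integral_Ioi_hermite_kernel {τ : ℝ} (hτ : 0 < τ) (p : ℝ) {j : ℕ} (hj : j < 3) {a : ℝ}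
    (ha : 0 ≤ a) :
    ∫ s in Set.Ioi a, hermitePoly (j + 1) τ (s - p) *
        Complex.exp (p / τ * s - (2 * (τ : ℂ))⁻¹ * (s : ℂ) ^ 2) =
      τ * (hermitePoly j τ (a - p) * Complex.exp (p / τ * a - (2 * (τ : ℂ))⁻¹ * (a : ℂ) ^ 2)) := by
  have hτ' : (τ : ℂ) ≠ 0 := by exact_mod_cast hτ.ne'
  have hone : ExpIntegrable fun _ ↦ 1 :=
    expIntegrable_of_norm_le_one aestronglyMeasurable_const (by simp)
  have hint (k : ℕ) := (integrable_hermite_kernel hone (q := ((p : ℂ), (τ : ℂ)))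
    (inv_two_mul_re_pos hτ) k).mono_set (Set.Ioi_subset_Ioi ha)
  simp only [one_mul] at hint
  rw [integral_Ioi_of_hasDerivAt_of_tendsto'
    (fun x _ ↦ hasDerivAt_hermite_kernel hτ' p hj x) (hint (j + 1))
    (tendsto_zero_of_hasDerivAt_of_integrableOn_Ioi (a := a)
      (fun x _ ↦ hasDerivAt_hermite_kernel hτ' p hj x) (hint (j + 1)) ((hint j).const_mul _))]
  ring

/-- Short ramps converge to the indicator of `(a, ∞)`, with the constant path `1` giving the
dominating function; the limiting moment is a boundary term at `a`. -/
theorem tendsto_hermiteMoment_ramp {τ : ℝ} (hτ : 0 < τ) (p : ℝ) {j : ℕ} (hj : j < 3) {a : ℝ}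
    (ha : 0 ≤ a) :
    Tendsto (fun n : ℕ ↦ hermiteMoment (fun s ↦ ramp a (a + 1 / ((n : ℝ) + 1)) s) (j + 1)
      (p, τ)) atTop (𝓝 (τ * (hermitePoly j τ (a - p) *
        Complex.exp (p / τ * a - (2 * (τ : ℂ))⁻¹ * (a : ℂ) ^ 2)))) := by
  have hone : ExpIntegrable fun _ ↦ 1 :=
    expIntegrable_of_norm_le_one aestronglyMeasurable_const (by simp)
  have hint := integrable_hermite_kernel hone (q := ((p : ℂ), (τ : ℂ)))
    (inv_two_mul_re_pos hτ) (j + 1)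
  simp only [one_mul] at hint
  rw [← integral_Ioi_hermite_kernel hτ p hj ha]
  have : ∫ s in Set.Ioi a, hermitePoly (j + 1) τ (s - p) *
        Complex.exp (p / τ * s - (2 * (τ : ℂ))⁻¹ * (s : ℂ) ^ 2) =
      ∫ s in Set.Ioi (0 : ℝ), ((Set.Ioi a).indicator (fun _ ↦ 1) s : ℂ) *
        (hermitePoly (j + 1) τ (s - p) *
          Complex.exp (p / τ * s - (2 * (τ : ℂ))⁻¹ * (s : ℂ) ^ 2)) := by
    have hind (s : ℝ) (z : ℂ) : ((Set.Ioi a).indicator (fun _ ↦ 1) s : ℂ) * z =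
        (Set.Ioi a).indicator (fun _ ↦ z) s := by
      by_cases hs : s ∈ Set.Ioi a <;> simp [hs]
    simp only [hind]
    have hK (K : ℝ → ℂ) : (fun s ↦ (Set.Ioi a).indicator (fun _ ↦ K s) s) =
      (Set.Ioi a).indicator K := rfl
    rw [hK, setIntegral_indicator measurableSet_Ioi,
      Set.inter_eq_self_of_subset_right (Set.Ioi_subset_Ioi ha)]
  rw [this]
  refine tendsto_integral_of_dominated_convergence _ (fun n ↦ ?_) hint.norm (fun n ↦ ?_) ?_
  · exact (Complex.continuous_ofReal.comp (continuous_ramp _ _)).aestronglyMeasurable.mul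
      hint.aestronglyMeasurable
  · refine .of_forall fun s ↦ ?_
    rw [norm_mul]
    exact mul_le_of_le_one_left (norm_nonneg _)
      (norm_ramp_le_one (by linarith [show 0 < 1 / ((n : ℝ) + 1) by positivity]) s)
  · exact .of_forall fun s ↦ (tendsto_ramp a s).mul_const _

/-- The times after which the increments of length `1 / (n + 1)` are taken. -/
def startTime (i : Fin 3) : ℝ := i + 1

theorem startTime_nonneg (i : Fin 3) : 0 ≤ startTime i := by unfold startTime; positivity

/-- The ramp over the `i`-th increment. -/
noncomputable def rampPath (n : ℕ) (i : Fin 3) (t : ℝ) : ℂ :=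
  ramp (startTime i) (startTime i + 1 / ((n : ℝ) + 1)) t

theorem expIntegrable_rampPath (n : ℕ) (i : Fin 3) : ExpIntegrable (rampPath n i) :=
  expIntegrable_ramp (by linarith [show 0 < 1 / ((n : ℝ) + 1) by positivity])

/-- The Hermite moments of the three ramps. -/
noncomputable def rampMatrix (n : ℕ) (q : ℝ × ℝ) : Matrix (Fin 3) (Fin 3) ℂ :=
  .of fun j i ↦ hermiteMoment (rampPath n i) (j + 1) (q.1, q.2)

theorem exists_rampMatrix_det_ne_zero {q : ℝ × ℝ} (hq : 0 < q.2) :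
    ∃ n, (rampMatrix n q).det ≠ 0 := by
  have hτ' : (q.2 : ℂ) ≠ 0 := by exact_mod_cast hq.ne'
  set A : Matrix (Fin 3) (Fin 3) ℂ := .of fun j i ↦ q.2 * (hermitePoly j q.2 (startTime i - q.1) *
    Complex.exp (q.1 / q.2 * startTime i - (2 * (q.2 : ℂ))⁻¹ * (startTime i : ℂ) ^ 2)) with hA
  have hlim : Tendsto (fun n ↦ rampMatrix n q) atTop (𝓝 A) := by
    refine tendsto_pi_nhds.2 fun j ↦ tendsto_pi_nhds.2 fun i ↦ ?_
    exact tendsto_hermiteMoment_ramp hq q.1 j.2 (startTime_nonneg i)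
  have hdet : Tendsto (fun n ↦ (rampMatrix n q).det) atTop (𝓝 A.det) :=
    ((continuous_id.matrix_det).tendsto A).comp hlim
  have hA0 : A.det ≠ 0 := by
    rw [Matrix.det_fin_three]
    simp only [hA, Matrix.of_apply]
    set E : Fin 3 → ℂ := fun i ↦
      Complex.exp (q.1 / q.2 * startTime i - (2 * (q.2 : ℂ))⁻¹ * (startTime i : ℂ) ^ 2) with hE
    have hEi (i : Fin 3) : Complex.exp (q.1 / q.2 * startTime i -
      (2 * (q.2 : ℂ))⁻¹ * (startTime i : ℂ) ^ 2) = E i := rfl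
    have hE0 (i : Fin 3) : E i ≠ 0 := Complex.exp_ne_zero _
    simp only [hEi]
    -- After extracting `τ E i` from each column, what remains are monic polynomials of degrees 0,
    -- 1, 2 at the times 1, 2, 3. Their determinant is the Vandermonde determinant, equal to `2`.
    have h : (2 : ℂ) * q.2 ^ 3 * E 0 * E 1 * E 2 ≠ 0 := by simp [hE0, hτ']
    convert h using 1
    simp only [Fin.isValue, Fin.val_zero, Fin.val_one, Fin.val_two, hermitePoly, startTime]
    push_cast
    ring
  exact (hdet.eventually_ne hA0).exists

/-! ### The null set of bad increments for a fixed residual. -/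

/-- A complex vector from its real and imaginary parts. -/
noncomputable def toComplexVec (z : (Fin 3 → ℝ) × (Fin 3 → ℝ)) (i : Fin 3) : ℂ :=
  z.1 i + z.2 i * Complex.I

/-- The Hermite moments of degrees `1, 2, 3` of the path `r + ∑ i, z i • rampPath n i`. -/
noncomputable def perturbedMoment (n : ℕ) (r : ℝ → ℂ) (z : (Fin 3 → ℝ) × (Fin 3 → ℝ))
    (q : ℝ × ℝ) (j : Fin 3) : ℂ :=
  hermiteMoment r (j + 1) (q.1, q.2) + (rampMatrix n q).mulVec (toComplexVec z) j

/-- A quantity which vanishes when the velocity vanishes and the next two derivatives are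
linearly dependent. -/
noncomputable def degeneracy (v : Fin 3 → ℂ) : ℝ :=
  ‖v 0‖ + |(starRingEnd ℂ (v 1) * v 2).im|

theorem degeneracy_nonneg (v : Fin 3 → ℂ) : 0 ≤ degeneracy v := by
  unfold degeneracy; positivity

/-- The values of the parameters at which the ramps determine the first three moments. -/
def regularSet (n : ℕ) : Set (ℝ × ℝ) := {q | 0 < q.2 ∧ (rampMatrix n q).det ≠ 0}

/-- Two real-dependent complex numbers lie on a common real line through `0`, so three real
parameters describe the pair; allowing signed radii also covers the case where one of them vanishes.
-/
theorem exists_polar_of_im_conj_mul_eq_zero {x y : ℂ} (h : (starRingEnd ℂ x * y).im = 0) :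
    ∃ s t θ : ℝ, x = s * Complex.exp (θ * Complex.I) ∧ y = t * Complex.exp (θ * Complex.I) := by
  rcases eq_or_ne x 0 with rfl | hx
  · exact ⟨0, ‖y‖, y.arg, by simp, (Complex.norm_mul_exp_arg_mul_I y).symm⟩
  · have hx' : (‖x‖ : ℂ) ≠ 0 := by simpa using hx
    have hE : Complex.exp (x.arg * Complex.I) = x / ‖x‖ := by
      rw [eq_div_iff hx', mul_comm, Complex.norm_mul_exp_arg_mul_I]
    refine ⟨‖x‖, (starRingEnd ℂ x * y).re / ‖x‖, x.arg,
      (Complex.norm_mul_exp_arg_mul_I x).symm, ?_⟩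
    have hre : (((starRingEnd ℂ x * y).re : ℝ) : ℂ) = starRingEnd ℂ x * y :=
      Complex.ext (by simp) (by simp only [Complex.ofReal_im, h])
    have hxx : starRingEnd ℂ x * x = (‖x‖ : ℂ) ^ 2 := Complex.conj_mul' x
    push_cast
    rw [hE, hre]
    field_simp
    rw [← hxx]
    ring

theorem differentiableAt_rampMatrix (n : ℕ) {q : ℝ × ℝ} (hq : 0 < q.2) (j i : Fin 3) :
    DifferentiableAt ℝ (fun q ↦ rampMatrix n q j i) q :=
  differentiableAt_hermiteMoment (expIntegrable_rampPath n i) _ hq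

theorem isOpen_regularSet (n : ℕ) : IsOpen (regularSet n) := by
  rw [isOpen_iff_mem_nhds]
  rintro q ⟨hq, hdet⟩
  have hc : ContinuousAt (fun q ↦ (rampMatrix n q).det) q :=
    (differentiableAt_det_fin_three (differentiableAt_rampMatrix n hq)).continuousAt
  filter_upwards [(isOpen_lt continuous_const continuous_snd).mem_nhds hq,
    hc.eventually_ne hdet] with q' h1 h2 using ⟨h1, h2⟩

theorem volume_exists_degeneracy_eq_zero (n : ℕ) {r : ℝ → ℂ} (hr : ExpIntegrable r) :
    volume {z | ∃ q ∈ regularSet n, degeneracy (perturbedMoment n r z q) = 0} = 0 := by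
  set v : (ℝ × ℝ) × ℝ × ℝ × ℝ → Fin 3 → ℂ := fun x ↦
    ![0, x.2.1 * Complex.exp (x.2.2.2 * Complex.I), x.2.2.1 * Complex.exp (x.2.2.2 * Complex.I)]
    with hv
  -- Solving the linear system for the increments that produce the degenerate moments `v`: five real
  -- parameters for a six-dimensional target.
  set ζ : (ℝ × ℝ) × ℝ × ℝ × ℝ → Fin 3 → ℂ := fun x ↦
    (rampMatrix n x.1)⁻¹.mulVec (fun j ↦ v x j - hermiteMoment r (j + 1) (x.1.1, x.1.2)) with hζ
  set Ψ : (ℝ × ℝ) × ℝ × ℝ × ℝ → (Fin 3 → ℝ) × (Fin 3 → ℝ) := fun x ↦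
    (fun i ↦ (ζ x i).re, fun i ↦ (ζ x i).im) with hΨ
  have hofReal : Differentiable ℝ (fun x : ℝ ↦ (x : ℂ)) := Complex.ofRealCLM.differentiable
  have hvd (j : Fin 3) : Differentiable ℝ (fun x ↦ v x j) := by
    have h1 : Differentiable ℝ (fun x : (ℝ × ℝ) × ℝ × ℝ × ℝ ↦ (x.2.1 : ℂ)) :=
      hofReal.comp (by fun_prop)
    have h2 : Differentiable ℝ (fun x : (ℝ × ℝ) × ℝ × ℝ × ℝ ↦ (x.2.2.1 : ℂ)) :=
      hofReal.comp (f := fun x : (ℝ × ℝ) × ℝ × ℝ × ℝ ↦ x.2.2.1) (by fun_prop)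
    have h3 : Differentiable ℝ (fun x : (ℝ × ℝ) × ℝ × ℝ × ℝ ↦ (x.2.2.2 : ℂ)) :=
      hofReal.comp (f := fun x : (ℝ × ℝ) × ℝ × ℝ × ℝ ↦ x.2.2.2) (by fun_prop)
    have h4 := (h3.mul_const Complex.I).cexp
    fin_cases j
    · exact differentiable_const _
    · exact h1.mul h4
    · exact h2.mul h4
  have hΨd (x) (hx : x ∈ {x : (ℝ × ℝ) × ℝ × ℝ × ℝ | x.1 ∈ regularSet n}) :
      DifferentiableAt ℝ Ψ x := by
    have hx1 : 0 < x.1.2 := hx.1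
    have hζd (i : Fin 3) : DifferentiableAt ℝ (fun x ↦ ζ x i) x := by
      simp only [hζ, Matrix.mulVec, dotProduct]
      refine DifferentiableAt.fun_sum fun j _ ↦ DifferentiableAt.fun_mul ?_ ?_
      · exact (differentiableAt_inv_fin_three (differentiableAt_rampMatrix n hx1)
          hx.2 i j).comp (f := Prod.fst) x differentiableAt_fst
      · exact (hvd j x).fun_sub ((differentiableAt_hermiteMoment hr (j + 1) hx1).comp
          (f := Prod.fst) x differentiableAt_fst)
    refine (differentiableAt_pi.2 fun i ↦ ?_).prodMk (differentiableAt_pi.2 fun i ↦ ?_)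
    · exact Complex.reCLM.differentiableAt.comp x (hζd i)
    · exact Complex.imCLM.differentiableAt.comp x (hζd i)
  have hHaar : (volume : Measure ((Fin 3 → ℝ) × (Fin 3 → ℝ))).IsAddHaarMeasure :=
    Measure.prod.instIsAddHaarMeasure volume volume
  refine measure_mono_null ?_ (addHaar_image_eq_zero_of_finrank_lt volume ?_ hΨd)
  · rintro z ⟨q, hq, hz⟩
    have h0 : perturbedMoment n r z q 0 = 0 := by
      have := abs_nonneg (starRingEnd ℂ (perturbedMoment n r z q 1) * perturbedMoment n r z q 2).im
      have := norm_nonneg (perturbedMoment n r z q 0)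
      rw [degeneracy] at hz
      exact norm_eq_zero.1 (by linarith)
    have h12 : (starRingEnd ℂ (perturbedMoment n r z q 1) * perturbedMoment n r z q 2).im = 0 := by
      rw [degeneracy, h0, norm_zero, zero_add] at hz
      exact abs_eq_zero.1 hz
    obtain ⟨s, t, θ, h1, h2⟩ := exists_polar_of_im_conj_mul_eq_zero h12
    have hvq : v (q, s, t, θ) = perturbedMoment n r z q := by
      ext j
      fin_cases j
      · exact h0.symm
      · exact h1.symm
      · exact h2.symm
    have hζq : ζ (q, s, t, θ) = toComplexVec z := by
      simp only [hζ, hvq]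
      have : (fun j : Fin 3 ↦ perturbedMoment n r z q j -
          hermiteMoment r (j + 1) ((q.1 : ℂ), (q.2 : ℂ))) =
          (rampMatrix n q).mulVec (toComplexVec z) := by
        ext j; simp [perturbedMoment]
      rw [this, Matrix.mulVec_mulVec, Matrix.nonsing_inv_mul _ (isUnit_iff_ne_zero.2 hq.2),
        Matrix.one_mulVec]
    refine ⟨(q, s, t, θ), hq, ?_⟩
    simp only [hΨ, hζq]
    ext i <;> simp [toComplexVec]
  · simp

/-! ### Tools on independence, measurability and modifications. -/

theorem absolutelyContinuous_pi {n : ℕ} {μ ν : Fin n → Measure ℝ} [∀ i, SigmaFinite (μ i)]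
    [∀ i, SigmaFinite (ν i)] (h : ∀ i, μ i ≪ ν i) : Measure.pi μ ≪ Measure.pi ν := by
  induction n with
  | zero =>
    rw [Subsingleton.elim μ ν]
  | succ n ih =>
    have hμ := (measurePreserving_piFinSuccAbove μ 0).symm
    have hν := (measurePreserving_piFinSuccAbove ν 0).symm
    rw [← hμ.map_eq, ← hν.map_eq]
    exact ((h 0).prod (ih fun i ↦ h _)).map (MeasurableEquiv.measurable _)

/-- The hypotheses make the joint law a fourfold product, so the variables may be regrouped. It is
meant for `A`, `C` the residuals and `B`, `D` the increments of the real and imaginary parts. -/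
theorem indepFun_prodMk_prodMk_of_indepFun {Ω α β γ δ : Type*} {mΩ : MeasurableSpace Ω}
    [MeasurableSpace α] [MeasurableSpace β] [MeasurableSpace γ] [MeasurableSpace δ]
    {P : Measure Ω} [IsProbabilityMeasure P] {A : Ω → α} {B : Ω → β} {C : Ω → γ} {D : Ω → δ}
    (hA : Measurable A) (hB : Measurable B) (hC : Measurable C) (hD : Measurable D)
    (hAB : IndepFun A B P) (hCD : IndepFun C D P)
    (h : IndepFun (fun ω ↦ (A ω, B ω)) (fun ω ↦ (C ω, D ω)) P) :
    IndepFun (fun ω ↦ (A ω, C ω)) (fun ω ↦ (B ω, D ω)) P := by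
  have := Measure.isProbabilityMeasure_map (μ := P) hA.aemeasurable
  have := Measure.isProbabilityMeasure_map (μ := P) hB.aemeasurable
  have := Measure.isProbabilityMeasure_map (μ := P) hC.aemeasurable
  have := Measure.isProbabilityMeasure_map (μ := P) hD.aemeasurable
  have hAC : IndepFun A C P := h.comp measurable_fst measurable_fst
  have hBD : IndepFun B D P := h.comp measurable_snd measurable_snd
  have eAB := (indepFun_iff_map_prod_eq_prod_map_map hA.aemeasurable hB.aemeasurable).1 hAB
  have eCD := (indepFun_iff_map_prod_eq_prod_map_map hC.aemeasurable hD.aemeasurable).1 hCD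
  have eAC := (indepFun_iff_map_prod_eq_prod_map_map hA.aemeasurable hC.aemeasurable).1 hAC
  have eBD := (indepFun_iff_map_prod_eq_prod_map_map hB.aemeasurable hD.aemeasurable).1 hBD
  have e := (indepFun_iff_map_prod_eq_prod_map_map (hA.prodMk hB).aemeasurable
    (hC.prodMk hD).aemeasurable).1 h
  rw [eAB, eCD] at e
  rw [indepFun_iff_measure_inter_preimage_eq_mul]
  intro s t hs ht
  set F : α × γ → ENNReal := s.indicator 1
  set G : β × δ → ENNReal := t.indicator 1
  have hF : Measurable F := measurable_one.indicator hs
  have hG : Measurable G := measurable_one.indicator ht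
  have e1 : P ((fun ω ↦ (A ω, C ω)) ⁻¹' s) = ∫⁻ c, ∫⁻ a, F (a, c) ∂(P.map A) ∂(P.map C) := by
    rw [← Measure.map_apply (hA.prodMk hC) hs, eAC, ← lintegral_prod_symm' _ hF,
      lintegral_indicator_one hs]
  have e2 : P ((fun ω ↦ (B ω, D ω)) ⁻¹' t) = ∫⁻ d, ∫⁻ b, G (b, d) ∂(P.map B) ∂(P.map D) := by
    rw [← Measure.map_apply (hB.prodMk hD) ht, eBD, ← lintegral_prod_symm' _ hG,
      lintegral_indicator_one ht]
  set S : Set ((α × β) × γ × δ) := {z | (z.1.1, z.2.1) ∈ s ∧ (z.1.2, z.2.2) ∈ t} with hSdef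
  have hS : MeasurableSet S := by
    refine MeasurableSet.inter (hs.preimage ?_) (ht.preimage ?_) <;> fun_prop
  have e3 : P ((fun ω ↦ (A ω, C ω)) ⁻¹' s ∩ (fun ω ↦ (B ω, D ω)) ⁻¹' t) =
      ∫⁻ y, ∫⁻ x, F (x.1, y.1) * G (x.2, y.2) ∂((P.map A).prod (P.map B))
        ∂((P.map C).prod (P.map D)) := by
    have : P ((fun ω ↦ (A ω, C ω)) ⁻¹' s ∩ (fun ω ↦ (B ω, D ω)) ⁻¹' t) =
        P.map (fun ω ↦ ((A ω, B ω), (C ω, D ω))) S := by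
      rw [Measure.map_apply ((hA.prodMk hB).prodMk (hC.prodMk hD)) hS]; rfl
    rw [this, e, ← lintegral_indicator_one hS,
      lintegral_prod_symm' _ (measurable_one.indicator hS)]
    refine lintegral_congr fun y ↦ lintegral_congr fun x ↦ ?_
    by_cases h1 : (x.1, y.1) ∈ s <;> by_cases h2 : (x.2, y.2) ∈ t <;> simp [S, F, G, h1, h2]
  rw [e1, e2, e3]
  have e4 (y : γ × δ) : ∫⁻ x, F (x.1, y.1) * G (x.2, y.2) ∂((P.map A).prod (P.map B)) =
      (∫⁻ a, F (a, y.1) ∂(P.map A)) * ∫⁻ b, G (b, y.2) ∂(P.map B) :=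
    lintegral_prod_mul (f := fun a ↦ F (a, y.1)) (g := fun b ↦ G (b, y.2))
      (hF.comp measurable_prodMk_right).aemeasurable
      (hG.comp measurable_prodMk_right).aemeasurable
  simp only [e4]
  exact lintegral_prod_mul (f := fun c ↦ ∫⁻ a, F (a, c) ∂(P.map A))
    (g := fun d ↦ ∫⁻ b, G (b, d) ∂(P.map B)) hF.lintegral_prod_left'.aemeasurable
    hG.lintegral_prod_left'.aemeasurable

/-- By independence the joint law is a product, so Fubini reduces the claim to sections, which are
null for `μ` and hence for the law of `ζ`. -/
theorem ae_notMem_of_indepFun {Ω α β : Type*} {mΩ : MeasurableSpace Ω} {mα : MeasurableSpace α}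
    {mβ : MeasurableSpace β} {P : Measure Ω} [IsProbabilityMeasure P] {ζ : Ω → α} {X : Ω → β}
    (hζ : Measurable ζ) (hX : Measurable X) (h : IndepFun X ζ P) {μ : Measure α}
    (hμ : P.map ζ ≪ μ) {B : Set (β × α)} (hB : MeasurableSet B)
    (hnull : ∀ ω, μ {z | (X ω, z) ∈ B} = 0) : ∀ᵐ ω ∂P, (X ω, ζ ω) ∉ B := by
  have := Measure.isProbabilityMeasure_map (μ := P) hζ.aemeasurable
  have := Measure.isProbabilityMeasure_map (μ := P) hX.aemeasurable
  have e := (indepFun_iff_map_prod_eq_prod_map_map hX.aemeasurable hζ.aemeasurable).1 h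
  have h0 : (P.map (fun ω ↦ (X ω, ζ ω))) B = 0 := by
    rw [e, Measure.measure_prod_null hB]
    refine (ae_map_iff hX.aemeasurable ?_).2 (.of_forall fun ω ↦ hμ (hnull ω))
    exact measurable_measure_prodMk_left hB (measurableSet_singleton 0)
  rw [Measure.map_apply (hX.prodMk hζ) hB] at h0
  exact measure_eq_zero_iff_ae_notMem.1 h0

theorem measurableSet_exists_eq_zero {X α : Type*} [TopologicalSpace X] [CompactSpace X]
    [SecondCountableTopology X] {mα : MeasurableSpace α} {F : X → α → ℝ}
    (hF : ∀ q, Measurable (F q)) (hc : ∀ a, Continuous fun q ↦ F q a)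
    (h0 : ∀ q a, 0 ≤ F q a) : MeasurableSet {a | ∃ q, F q a = 0} := by
  obtain ⟨s, hs, hsd⟩ := TopologicalSpace.exists_countable_dense X
  -- On a compact space a nonnegative continuous function has a zero exactly when it takes
  -- arbitrarily small values on a countable dense set, so the uncountable union becomes a countable
  -- operation.
  have : {a | ∃ q, F q a = 0} = ⋂ m : ℕ, ⋃ q ∈ s, {a | F q a < 1 / ((m : ℝ) + 1)} := by
    ext a
    simp only [Set.mem_ofPred_eq, Set.mem_iInter, Set.mem_iUnion, exists_prop]
    constructor
    · rintro ⟨q, hq⟩ m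
      obtain ⟨q', h1, h2⟩ := hsd.exists_mem_open
        (isOpen_lt (hc a) (continuous_const (y := 1 / ((m : ℝ) + 1))))
        ⟨q, show F q a < _ by rw [hq]; positivity⟩
      exact ⟨q', h1, h2⟩
    · intro h
      obtain ⟨q₁, -, -⟩ := h 0
      obtain ⟨q₀, -, hq₀⟩ := isCompact_univ.exists_isMinOn ⟨q₁, Set.mem_univ _⟩
        (hc a).continuousOn
      refine ⟨q₀, (h0 q₀ a).antisymm' (not_lt.1 fun hpos ↦ ?_)⟩
      obtain ⟨m, hm⟩ := exists_nat_one_div_lt hpos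
      obtain ⟨q, -, hq⟩ := h m
      exact absurd (hq₀ (Set.mem_univ q)) (not_le.2 (hq.trans hm))
  rw [this]
  exact .iInter fun m ↦ .biUnion hs fun q _ ↦ measurableSet_lt (hF q) measurable_const

/-- A process whose paths almost surely lie in a class of continuous functions has a measurable
modification all of whose paths lie in this class. -/
theorem exists_measurable_modification {Ω : Type*} {mΩ : MeasurableSpace Ω} {P : Measure Ω}
    {W : ℝ≥0 → Ω → ℂ} (hW : ∀ t, AEMeasurable (W t) P) {good : (ℝ≥0 → ℂ) → Prop}
    (h0 : good fun _ ↦ 0) (hc : ∀ w, good w → Continuous w)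
    (hae : ∀ᵐ ω ∂P, good fun t ↦ W t ω) :
    ∃ W' : ℝ≥0 → Ω → ℂ, (∀ t, Measurable (W' t)) ∧ (∀ ω, good fun t ↦ W' t ω) ∧
      ∀ᵐ ω ∂P, ∀ t, W' t ω = W t ω := by
  obtain ⟨s, hs, hsd⟩ := TopologicalSpace.exists_countable_dense ℝ≥0
  have := hs.to_subtype
  have hall : ∀ᵐ ω ∂P, good (fun t ↦ W t ω) ∧ ∀ t : s, W t ω = (hW t).mk _ ω := by
    filter_upwards [hae, ae_all_iff.2 fun t : s ↦ (hW t).ae_eq_mk] with ω h1 h2 using ⟨h1, h2⟩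
  obtain ⟨A, hA, hAm, hAP⟩ := hall.exists_measurable_mem
  classical
  set W' : ℝ≥0 → Ω → ℂ := fun t ↦ A.indicator (W t) with hW'
  refine ⟨W', fun t ↦ ?_, fun ω ↦ ?_, ?_⟩
  · have hgood (ω : Ω) : Continuous fun t ↦ W' t ω := by
      by_cases hω : ω ∈ A
      · simpa [hW', hω] using hc _ (hAP ω hω).1
      · simp [hW', hω, continuous_const]
    -- At times of the dense set the process agrees on `A` with measurable versions; other times are
    -- reached as pointwise limits by continuity.
    obtain ⟨u, hu, hut⟩ := mem_closure_iff_seq_limit.1 (hsd t)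
    refine measurable_of_tendsto_metrizable (f := fun k ↦ W' (u k)) (fun k ↦ ?_)
      (tendsto_pi_nhds.2 fun ω ↦ ((hgood ω).tendsto t).comp hut)
    have : W' (u k) = A.indicator ((hW (u k)).mk _) := by
      ext ω
      by_cases hω : ω ∈ A
      · simpa [hW', hω] using (hAP ω hω).2 ⟨u k, hu k⟩
      · simp [hW', hω]
    rw [this]
    exact (hW (u k)).measurable_mk.indicator hAm
  · by_cases hω : ω ∈ A
    · simpa [hW', hω] using (hAP ω hω).1
    · simpa [hW', hω] using h0
  · filter_upwards [hA] with ω hω t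
    simp [hW', hω]

/-! ### Brownian increments and their independent residual. -/

/-- The start of the `i`-th increment. -/
noncomputable def incrStart (i : Fin 3) : ℝ≥0 := i + 1

/-- The end of the `i`-th increment. -/
noncomputable def incrEnd (n : ℕ) (i : Fin 3) : ℝ≥0 := i + 1 + 1 / (n + 1)

/-- The increments of a real process. -/
noncomputable def increment (n : ℕ) (X : ℝ≥0 → ℝ) (i : Fin 3) : ℝ :=
  X (incrEnd n i) - X (incrStart i)

/-- The ramp over the `i`-th increment, as a real function. -/
noncomputable def realRamp (n : ℕ) (i : Fin 3) (t : ℝ≥0) : ℝ :=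
  ramp (incrStart i) (incrEnd n i) t

/-- A real process minus its projection on the increments. -/
noncomputable def incrResidual (n : ℕ) (X : ℝ≥0 → ℝ) (t : ℝ≥0) : ℝ :=
  X t - ∑ i, increment n X i * realRamp n i t

theorem incrStart_lt_incrEnd (n : ℕ) (i : Fin 3) : incrStart i < incrEnd n i := by
  unfold incrStart incrEnd
  exact lt_add_of_pos_right _ (by positivity)

section Brownian

variable {Ω : Type*} {mΩ : MeasurableSpace Ω} {P : Measure Ω} {X : ℝ≥0 → Ω → ℝ}

theorem iIndepFun_increment (hX : IsPreBrownianReal X P) (n : ℕ) :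
    iIndepFun (fun i ω ↦ increment n (X · ω) i) P := by
  -- Starts and ends of the increments are interleaved into one monotone sequence of times; the
  -- wanted increments are those beginning at even indices.
  set t : ℕ → ℝ≥0 := fun k ↦ (k / 2 : ℕ) + 1 + if k % 2 = 1 then 1 / ((n : ℝ≥0) + 1) else 0
    with ht
  have hmono : Monotone t := by
    refine monotone_nat_of_le_succ fun k ↦ ?_
    rcases Nat.even_or_odd' k with ⟨m, rfl | rfl⟩
    · have h1 : (2 * m) / 2 = m := by omega
      have h2 : (2 * m + 1) / 2 = m := by omega
      have h3 : (2 * m) % 2 = 0 := by omega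
      have h4 : (2 * m + 1) % 2 = 1 := by omega
      simp [ht, h1, h2, h3, h4]
    · have h1 : (2 * m + 1) / 2 = m := by omega
      have h2 : (2 * m + 1 + 1) / 2 = m + 1 := by omega
      have h3 : (2 * m + 1) % 2 = 1 := by omega
      have h4 : (2 * m + 1 + 1) % 2 = 0 := by omega
      have h5 : 1 / ((n : ℝ≥0) + 1) ≤ 1 := by
        rw [div_le_one (by positivity)]; simp
      simp only [ht, h1, h2, h3, h4, if_true, zero_ne_one, if_false, add_zero]
      push_cast
      gcongr
  have h := (hX.hasIndepIncrements.nat hmono).precomp (g := fun i : Fin 3 ↦ 2 * (i : ℕ))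
    (fun i j hij ↦ by simpa [Fin.ext_iff] using hij)
  convert h using 4 with i ω
  have h1 : (2 * (i : ℕ)) / 2 = i := by omega
  have h2 : (2 * (i : ℕ) + 1) / 2 = i := by omega
  have h3 : (2 * (i : ℕ)) % 2 = 0 := by omega
  have h4 : (2 * (i : ℕ) + 1) % 2 = 1 := by omega
  simp [increment, incrEnd, incrStart, ht, h1, h2, h3, h4]

theorem aemeasurable_increment (hX : IsPreBrownianReal X P) (n : ℕ) (i : Fin 3) :
    AEMeasurable (fun ω ↦ increment n (X · ω) i) P :=
  (hX.aemeasurable _).sub (hX.aemeasurable _)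

theorem map_increment_absolutelyContinuous (hX : IsPreBrownianReal X P) (n : ℕ) :
    P.map (fun ω ↦ increment n (X · ω)) ≪ volume := by
  have := hX.isGaussianProcess.isProbabilityMeasure
  have h1 := (iIndepFun_iff_map_fun_eq_pi_map (aemeasurable_increment hX n)).1
    (iIndepFun_increment hX n)
  rw [show (fun ω ↦ increment n (X · ω)) = fun ω i ↦ increment n (X · ω) i from rfl, h1]
  have hlaw (i : Fin 3) := hX.hasLaw_sub (incrEnd n i) (incrStart i)
  have hmap (i : Fin 3) : P.map (fun ω ↦ increment n (X · ω) i) =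
      gaussianReal 0 (nndist (incrEnd n i : ℝ) (incrStart i)) := (hlaw i).map_eq
  simp only [hmap]
  refine absolutelyContinuous_pi fun i ↦ gaussianReal_absolutelyContinuous _ ?_
  rw [ne_eq, nndist_eq_zero]
  exact_mod_cast (incrStart_lt_incrEnd n i).ne'

/-- This explains the choice of the ramp: it is the regression coefficient of `X t` on the
increment, namely covariance over variance. -/
theorem covariance_increment (hX : IsPreBrownianReal X P) (n : ℕ) (t : ℝ≥0) (i : Fin 3) :
    cov[X t, fun ω ↦ increment n (X · ω) i; P] =
      realRamp n i t * ((incrEnd n i : ℝ) - incrStart i) := by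
  have hmem (t : ℝ≥0) := (hX.isGaussianProcess.hasGaussianLaw_eval t).memLp_two
  have := hX.isGaussianProcess.isProbabilityMeasure
  have hne : (incrEnd n i : ℝ) - incrStart i ≠ 0 :=
    sub_ne_zero.2 (by exact_mod_cast (incrStart_lt_incrEnd n i).ne')
  simp only [increment]
  rw [covariance_fun_sub_right (hmem _) (hmem _) (hmem _), hX.covariance_fun_eval,
    hX.covariance_fun_eval, realRamp, ramp, div_mul_cancel₀ _ hne]
  simp

theorem memLp_increment (hX : IsPreBrownianReal X P) (n : ℕ) (i : Fin 3) :
    MemLp (fun ω ↦ increment n (X · ω) i) 2 P :=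
  hX.isGaussianProcess.hasGaussianLaw_fun_sub.memLp_two

theorem covariance_increment_of_ne (hX : IsPreBrownianReal X P) (n : ℕ) {i j : Fin 3}
    (hij : i ≠ j) :
    cov[fun ω ↦ increment n (X · ω) i, fun ω ↦ increment n (X · ω) j; P] = 0 :=
  ((iIndepFun_increment hX n).indepFun hij).covariance_eq_zero (memLp_increment hX n i)
    (memLp_increment hX n j)

theorem covariance_increment_self (hX : IsPreBrownianReal X P) (n : ℕ) (i : Fin 3) :
    cov[fun ω ↦ increment n (X · ω) i, fun ω ↦ increment n (X · ω) i; P] =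
      (incrEnd n i : ℝ) - incrStart i := by
  have h := hX.hasLaw_sub (incrEnd n i) (incrStart i)
  rw [covariance_self (aemeasurable_increment hX n i)]
  have h2 := h.variance_eq
  rw [variance_id_gaussianReal, coe_nndist, Real.dist_eq, abs_of_pos] at h2
  · exact h2
  · exact sub_pos.2 (by exact_mod_cast incrStart_lt_incrEnd n i)

theorem covariance_residual_increment (hX : IsPreBrownianReal X P) (n : ℕ) (t : ℝ≥0)
    (j : Fin 3) :
    cov[fun ω ↦ incrResidual n (X · ω) t, fun ω ↦ increment n (X · ω) j; P] = 0 := by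
  have := hX.isGaussianProcess.isProbabilityMeasure
  have hmem := (hX.isGaussianProcess.hasGaussianLaw_eval t).memLp_two
  have hsum (i : Fin 3) : MemLp (fun ω ↦ increment n (X · ω) i * realRamp n i t) 2 P :=
    (memLp_increment hX n i).mul_const _
  simp only [incrResidual]
  rw [covariance_fun_sub_left hmem (memLp_finsetSum _ fun i _ ↦ hsum i) (memLp_increment hX n j),
    covariance_increment hX, covariance_fun_sum_left hsum (memLp_increment hX n j),
    Finset.sum_eq_single j]
  · rw [covariance_mul_const_left, covariance_increment_self hX]
    ring
  · intro i _ hij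
    rw [covariance_mul_const_left, covariance_increment_of_ne hX n hij, zero_mul]
  · simp

/-- Residual and increments are linear in finitely many values of `X`, hence jointly Gaussian; being
uncorrelated, they are independent. -/
theorem indepFun_residual_increment (hX : IsPreBrownianReal X P) (n : ℕ) :
    IndepFun (fun ω t ↦ incrResidual n (X · ω) t) (fun ω i ↦ increment n (X · ω) i) P := by
  classical
  refine IsGaussianProcess.indepFun_of_covariance_eq_zero (X := fun t ω ↦ incrResidual n (X · ω) t)
    (Y := fun i ω ↦ increment n (X · ω) i) ?_ (fun t ↦ ?_) (aemeasurable_increment hX n)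
    (covariance_residual_increment hX n)
  · apply hX.isGaussianProcess.of_isGaussianProcess
    rintro (t | i)
    · exact ⟨insert t (Finset.univ.image incrStart ∪ Finset.univ.image (incrEnd n)),
        { toFun x := x ⟨t, by simp⟩ - ∑ i, (x ⟨incrEnd n i, by simp⟩ -
            x ⟨incrStart i, by simp⟩) * realRamp n i t
          map_add' x y := by simp only [Pi.add_apply, Fin.sum_univ_three]; ring
          map_smul' c x := by
            simp only [Pi.smul_apply, smul_eq_mul, Fin.sum_univ_three, RingHom.id_apply]; ring },
        fun ω ↦ rfl⟩
    · exact ⟨{incrStart i, incrEnd n i},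
        { toFun x := x ⟨incrEnd n i, by simp⟩ - x ⟨incrStart i, by simp⟩
          map_add' x y := by simp; abel
          map_smul' c x := by simp; ring }, fun ω ↦ rfl⟩
  · exact (hX.aemeasurable t).sub (Finset.aemeasurable_fun_sum _ fun i _ ↦
      (aemeasurable_increment hX n i).mul_const _)

theorem integral_norm_le (hX : IsPreBrownianReal X P) (t : ℝ≥0) :
    ∫ ω, ‖X t ω‖ ∂P ≤ 1 + t := by
  have := hX.isGaussianProcess.isProbabilityMeasure
  have hmem := (hX.isGaussianProcess.hasGaussianLaw_eval t).memLp_two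
  have hvar : ∫ ω, X t ω ^ 2 ∂P = t := by
    have h := (hX.hasLaw_eval t).variance_eq
    rw [variance_id_gaussianReal, variance_of_integral_eq_zero (hX.aemeasurable t)
      (hX.integral_eval t)] at h
    exact h
  calc ∫ ω, ‖X t ω‖ ∂P ≤ ∫ ω, (1 + X t ω ^ 2) ∂P := by
        refine integral_mono (hX.integrable_eval t).norm
          ((integrable_const _).add hmem.integrable_sq) fun ω ↦ ?_
        simp only [Real.norm_eq_abs]
        nlinarith [sq_abs (X t ω), sq_nonneg (|X t ω| - 1), abs_nonneg (X t ω)]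
    _ = 1 + t := by
        rw [integral_add (integrable_const _) hmem.integrable_sq, hvar]
        simp

/-- By Fubini it suffices that the expected absolute value is integrable against `e ^ (-s)`, and
that expectation grows at most linearly. -/
theorem ae_integrableOn_mul_exp_neg (hX : IsPreBrownianReal X P)
    (hm : Measurable (Function.uncurry X)) :
    ∀ᵐ ω ∂P, IntegrableOn (fun s : ℝ ↦ X s.toNNReal ω * Real.exp (-s)) (Set.Ioi 0) := by
  have := hX.isGaussianProcess.isProbabilityMeasure
  have hm' : Measurable fun z : Ω × ℝ ↦ X z.2.toNNReal z.1 * Real.exp (-z.2) :=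
    (hm.comp ((measurable_real_toNNReal.comp measurable_snd).prodMk measurable_fst)).mul
      (by fun_prop)
  have hint : Integrable (fun z : Ω × ℝ ↦ X z.2.toNNReal z.1 * Real.exp (-z.2))
      (P.prod (volume.restrict (Set.Ioi 0))) := by
    rw [integrable_prod_iff' hm'.aestronglyMeasurable]
    refine ⟨.of_forall fun s ↦ (hX.integrable_eval s.toNNReal).mul_const (Real.exp (-s)), ?_⟩
    have hb : IntegrableOn (fun s : ℝ ↦ 2 * Real.exp (-(1 / 2) * s)) (Set.Ioi 0) :=
      (integrableOn_exp_mul_Ioi (by norm_num) 0).const_mul 2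
    refine hb.mono' ?_ ?_
    · exact (hm'.stronglyMeasurable.norm.integral_prod_left).aestronglyMeasurable
    · filter_upwards [ae_restrict_mem measurableSet_Ioi] with s hs
      have hs : 0 < s := hs
      rw [Real.norm_of_nonneg (integral_nonneg fun _ ↦ norm_nonneg _)]
      simp only [norm_mul, Real.norm_of_nonneg (Real.exp_nonneg _)]
      rw [integral_mul_const]
      have h1 := integral_norm_le hX s.toNNReal
      rw [Real.coe_toNNReal _ hs.le] at h1
      -- This gives `1 + s ≤ 2 (1 + s / 2) ≤ 2 e ^ (s / 2)`, which leaves the decay `e ^ (-s / 2)`.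
      have h2 := Real.add_one_le_exp (s / 2)
      have h3 : Real.exp (-(1 / 2) * s) = Real.exp (s / 2) * Real.exp (-s) := by
        rw [← Real.exp_add]; ring_nf
      rw [h3, ← mul_assoc]
      gcongr
      linarith
  exact hint.prod_right_ae

end Brownian

theorem hermiteMoment_congr {v w : ℝ → ℂ} (h : ∀ s, 0 < s → v s = w s) (j : ℕ) (q : ℂ × ℂ) :
    hermiteMoment v j q = hermiteMoment w j q :=
  setIntegral_congr_fun measurableSet_Ioi fun s hs ↦ by simp only [h s hs]

theorem hermiteMoment_add_sum {r : ℝ → ℂ} (hr : ExpIntegrable r) (n : ℕ)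
    (z : (Fin 3 → ℝ) × (Fin 3 → ℝ)) {q : ℝ × ℝ} (hq : 0 < q.2) (j : Fin 3) :
    hermiteMoment (fun s ↦ r s + ∑ i, toComplexVec z i * rampPath n i s) (j + 1) (q.1, q.2) =
      perturbedMoment n r z q j := by
  have hq' := inv_two_mul_re_pos hq
  have h0 := integrable_hermite_kernel hr (q := ((q.1 : ℂ), (q.2 : ℂ))) hq' (j + 1)
  have h1 (i : Fin 3) := (integrable_hermite_kernel (expIntegrable_rampPath n i)
    (q := ((q.1 : ℂ), (q.2 : ℂ))) hq' (j + 1)).const_mul (toComplexVec z i)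
  simp only [perturbedMoment, Matrix.mulVec, dotProduct, rampMatrix, Matrix.of_apply]
  simp only [hermiteMoment]
  rw [Finset.sum_congr rfl fun i _ ↦ mul_comm _ (toComplexVec z i)]
  simp only [← integral_const_mul]
  rw [← integral_finsetSum _ fun i _ ↦ h1 i,
    ← integral_add h0 (integrable_finsetSum _ fun i _ ↦ h1 i)]
  congr 1 with s
  rw [add_mul, Finset.sum_mul]
  simp only [mul_assoc]

/-! ### Splitting the complex path into residual and ramps. -/

/-- The real and imaginary increments of a complex path. -/
noncomputable def complexIncrement (n : ℕ) (w : ℝ≥0 → ℂ) : (Fin 3 → ℝ) × (Fin 3 → ℝ) :=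
  (increment n fun t ↦ (w t).re, increment n fun t ↦ (w t).im)

/-- A complex path minus its projection on the increments. -/
noncomputable def complexResidual (n : ℕ) (w : ℝ≥0 → ℂ) (t : ℝ≥0) : ℂ :=
  incrResidual n (fun t ↦ (w t).re) t + incrResidual n (fun t ↦ (w t).im) t * Complex.I

theorem realRamp_toNNReal (n : ℕ) (i : Fin 3) {s : ℝ} (hs : 0 < s) :
    (realRamp n i s.toNNReal : ℂ) = rampPath n i s := by
  simp [realRamp, rampPath, incrStart, incrEnd, startTime, Real.coe_toNNReal _ hs.le]

theorem eq_complexResidual_add (n : ℕ) (w : ℝ≥0 → ℂ) (t : ℝ≥0) :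
    w t = complexResidual n w t +
      ∑ i, toComplexVec (complexIncrement n w) i * (realRamp n i t : ℂ) := by
  conv_lhs => rw [← Complex.re_add_im (w t)]
  simp only [complexResidual, complexIncrement, toComplexVec, incrResidual, Fin.sum_univ_three]
  push_cast
  ring

theorem ExpIntegrable.complexResidual {w : ℝ≥0 → ℂ} (hw : ExpIntegrable fun s ↦ w s.toNNReal)
    (n : ℕ) : ExpIntegrable fun s ↦ complexResidual n w s.toNNReal := by
  have h1 (i : Fin 3) := (expIntegrable_rampPath n i).const_mul
    (toComplexVec (complexIncrement n w) i)
  have h2 : IntegrableOn (fun s ↦ w s.toNNReal * (Real.exp (-s) : ℂ) - ∑ i,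
      toComplexVec (complexIncrement n w) i * (rampPath n i s * (Real.exp (-s) : ℂ)))
      (Set.Ioi 0) := Integrable.sub hw (integrable_finsetSum _ fun i _ ↦ h1 i)
  refine h2.congr_fun (fun s hs ↦ ?_) measurableSet_Ioi
  have h3 := eq_complexResidual_add n w s.toNNReal
  simp only [realRamp_toNNReal n _ (show 0 < s from hs)] at h3
  simp only [h3, ← mul_assoc, ← Finset.sum_mul]
  ring

theorem hermiteMoment_path (n : ℕ) {w : ℝ≥0 → ℂ} (hw : ExpIntegrable fun s ↦ w s.toNNReal)
    {q : ℝ × ℝ} (hq : 0 < q.2) (j : Fin 3) :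
    hermiteMoment (fun s ↦ w s.toNNReal) (j + 1) (q.1, q.2) =
      perturbedMoment n (fun s ↦ complexResidual n w s.toNNReal) (complexIncrement n w) q j := by
  rw [← hermiteMoment_add_sum (hw.complexResidual n) n _ hq]
  refine hermiteMoment_congr (fun s hs ↦ ?_) _ _
  rw [eq_complexResidual_add n w s.toNNReal]
  simp only [realRamp_toNNReal n _ hs]

theorem measurable_hermiteMoment {Ω : Type*} {mΩ : MeasurableSpace Ω} {R : ℝ≥0 → Ω → ℂ}
    (hR : Measurable (Function.uncurry R)) (j : ℕ) (q : ℂ × ℂ) :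
    Measurable fun ω ↦ hermiteMoment (fun s ↦ R s.toNNReal ω) j q := by
  have h1 : Measurable fun z : Ω × ℝ ↦ R z.2.toNNReal z.1 :=
    hR.comp ((measurable_real_toNNReal.comp measurable_snd).prodMk measurable_fst)
  have h2 : Measurable fun s : ℝ ↦ hermitePoly j q.2 (s - q.1) *
      Complex.exp (q.1 / q.2 * s - (2 * q.2)⁻¹ * (s : ℂ) ^ 2) := by
    match j with
    | 0 => simp only [hermitePoly]; fun_prop
    | 1 => simp only [hermitePoly]; fun_prop
    | 2 => simp only [hermitePoly]; fun_prop
    | 3 => simp only [hermitePoly]; fun_prop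
    | _ + 4 => simp only [hermitePoly]; fun_prop
  exact ((h1.mul (h2.comp measurable_snd)).stronglyMeasurable.integral_prod_right'
    (ν := volume.restrict (Set.Ioi (0 : ℝ)))).measurable

theorem continuous_toComplexVec (i : Fin 3) : Continuous fun z ↦ toComplexVec z i := by
  unfold toComplexVec
  fun_prop

theorem measurableSet_exists_degeneracy_eq_zero {Ω : Type*} {mΩ : MeasurableSpace Ω}
    {R : ℝ≥0 → Ω → ℂ} (hR : Measurable (Function.uncurry R))
    (hexp : ∀ ω, ExpIntegrable fun s ↦ R s.toNNReal ω) (n : ℕ) {K : Set (ℝ × ℝ)}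
    (hK : IsCompact K) (hK' : K ⊆ regularSet n) :
    MeasurableSet {x : Ω × (Fin 3 → ℝ) × (Fin 3 → ℝ) | ∃ q ∈ K,
      degeneracy (perturbedMoment n (fun s ↦ R s.toNNReal x.1) x.2 q) = 0} := by
  have := isCompact_iff_compactSpace.1 hK
  have hmeas (q : ℝ × ℝ) (j : Fin 3) : Measurable fun x : Ω × (Fin 3 → ℝ) × (Fin 3 → ℝ) ↦
      perturbedMoment n (fun s ↦ R s.toNNReal x.1) x.2 q j := by
    refine ((measurable_hermiteMoment hR _ _).comp measurable_fst).add ?_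
    simp only [Matrix.mulVec, dotProduct]
    exact Finset.measurable_fun_sum _ fun i _ ↦ measurable_const.mul
      ((continuous_toComplexVec i).measurable.comp measurable_snd)
  have hcont (x : Ω × (Fin 3 → ℝ) × (Fin 3 → ℝ)) (j : Fin 3) : Continuous fun q : K ↦
      perturbedMoment n (fun s ↦ R s.toNNReal x.1) x.2 q j := by
    refine continuous_iff_continuousAt.2 fun q ↦ ?_
    have hq : 0 < (q : ℝ × ℝ).2 := (hK' q.2).1
    refine ContinuousAt.comp (g := fun q : ℝ × ℝ ↦
      perturbedMoment n (fun s ↦ R s.toNNReal x.1) x.2 q j) ?_ continuousAt_subtype_val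
    refine (differentiableAt_hermiteMoment (hexp x.1) _ hq).continuousAt.add ?_
    simp only [Matrix.mulVec, dotProduct]
    exact tendsto_finsetSum _ fun i _ ↦
      ((differentiableAt_rampMatrix n hq j i).continuousAt.mul continuousAt_const)
  have := measurableSet_exists_eq_zero (X := K) (mα := Prod.instMeasurableSpace)
    (F := fun (q : K) (x : Ω × (Fin 3 → ℝ) × (Fin 3 → ℝ)) ↦ degeneracy (perturbedMoment n (fun s ↦ R s.toNNReal x.1) x.2 q))
    (fun q ↦ ?_) (fun x ↦ ?_) (fun q x ↦ degeneracy_nonneg _)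
  · simpa [Subtype.exists] using this
  · have h0 := hmeas q 0
    have h1 := hmeas q 1
    have h2 := hmeas q 2
    unfold degeneracy
    exact h0.norm.add (measurable_norm.comp (Complex.measurable_im.comp
      ((Complex.continuous_conj.measurable.comp h1).mul h2)))
  · have h0 := hcont x 0
    have h1 := hcont x 1
    have h2 := hcont x 2
    unfold degeneracy
    exact h0.norm.add (continuous_abs.comp (Complex.continuous_im.comp
      ((Complex.continuous_conj.comp h1).mul h2)))

/-- Measurability of the bad event is available only for compact parameter sets; countably many of
them exhaust `regularSet n`. -/
theorem isSigmaCompact_regularSet (n : ℕ) : IsSigmaCompact (regularSet n) := by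
  have := (isOpen_regularSet n).locallyCompactSpace
  exact isSigmaCompact_iff_sigmaCompactSpace.2 inferInstance

/-! ### Almost sure nondegeneracy for all parameters at once. -/

section

variable {Ω : Type*} {mΩ : MeasurableSpace Ω} {P : Measure Ω} {W : ℝ≥0 → Ω → ℂ}

theorem measurable_increment (hm : ∀ t, Measurable (W t)) (n : ℕ) :
    Measurable fun ω ↦ complexIncrement n fun t ↦ W t ω := by
  have h1 (t : ℝ≥0) : Measurable fun ω ↦ (W t ω).re := Complex.measurable_re.comp (hm t)
  have h2 (t : ℝ≥0) : Measurable fun ω ↦ (W t ω).im := Complex.measurable_im.comp (hm t)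
  exact (measurable_pi_lambda _ fun i ↦ (h1 _).sub (h1 _)).prodMk
    (measurable_pi_lambda _ fun i ↦ (h2 _).sub (h2 _))

theorem indepFun_complexResidual (hW : IsComplexBrownian W P) (hm : ∀ t, Measurable (W t))
    (n : ℕ) : IndepFun (fun ω t ↦ complexResidual n (fun t ↦ W t ω) t)
      (fun ω ↦ complexIncrement n fun t ↦ W t ω) P := by
  have := hW.re.isGaussianProcess.isProbabilityMeasure
  have h1 (t : ℝ≥0) : Measurable fun ω ↦ (W t ω).re := Complex.measurable_re.comp (hm t)
  have h2 (t : ℝ≥0) : Measurable fun ω ↦ (W t ω).im := Complex.measurable_im.comp (hm t)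
  have hi (X : ℝ≥0 → Ω → ℝ) (hX : ∀ t, Measurable (X t)) :
      Measurable fun ω ↦ increment n (X · ω) := measurable_pi_lambda _ fun i ↦ (hX _).sub (hX _)
  have hr (X : ℝ≥0 → Ω → ℝ) (hX : ∀ t, Measurable (X t)) :
      Measurable fun ω ↦ incrResidual n (X · ω) := measurable_pi_lambda _ fun t ↦
    (hX _).sub (Finset.measurable_fun_sum _ fun i _ ↦
      ((measurable_pi_apply i).comp (hi X hX)).mul_const _)
  have hpath : Measurable fun x : ℝ≥0 → ℝ ↦ (incrResidual n x, increment n x) := by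
    have hid (t : ℝ≥0) : Measurable fun x : ℝ≥0 → ℝ ↦ x t := measurable_pi_apply t
    have hinc : Measurable fun x : ℝ≥0 → ℝ ↦ increment n x :=
      measurable_pi_lambda _ fun i ↦ (hid _).sub (hid _)
    exact (measurable_pi_lambda _ fun t ↦ (hid _).sub (Finset.measurable_fun_sum _ fun i _ ↦
      ((measurable_pi_apply i).comp hinc).mul_const _)).prodMk hinc
  have key := indepFun_prodMk_prodMk_of_indepFun (hr _ h1) (hi _ h1) (hr _ h2) (hi _ h2)
    (indepFun_residual_increment hW.re.toIsPreBrownianReal n)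
    (indepFun_residual_increment hW.im.toIsPreBrownianReal n) (hW.indep.comp hpath hpath)
  have hcomb : Measurable fun x : (ℝ≥0 → ℝ) × (ℝ≥0 → ℝ) ↦
      fun t ↦ (x.1 t : ℂ) + x.2 t * Complex.I :=
    measurable_pi_lambda _ fun t ↦
      (Complex.measurable_ofReal.comp ((measurable_pi_apply t).comp measurable_fst)).add
      ((Complex.measurable_ofReal.comp ((measurable_pi_apply t).comp measurable_snd)).mul_const _)
  exact key.comp hcomb measurable_id

theorem map_complexIncrement_absolutelyContinuous (hW : IsComplexBrownian W P)
    (hm : ∀ t, Measurable (W t)) (n : ℕ) :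
    P.map (fun ω ↦ complexIncrement n fun t ↦ W t ω) ≪ volume := by
  have := hW.re.isGaussianProcess.isProbabilityMeasure
  have h1 (t : ℝ≥0) : Measurable fun ω ↦ (W t ω).re := Complex.measurable_re.comp (hm t)
  have h2 (t : ℝ≥0) : Measurable fun ω ↦ (W t ω).im := Complex.measurable_im.comp (hm t)
  have hinc : Measurable fun x : ℝ≥0 → ℝ ↦ increment n x :=
    measurable_pi_lambda _ fun i ↦ (measurable_pi_apply _).sub (measurable_pi_apply _)
  have e := (indepFun_iff_map_prod_eq_prod_map_map
    (hinc.comp (measurable_pi_lambda _ h1)).aemeasurable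
    (hinc.comp (measurable_pi_lambda _ h2)).aemeasurable).1 (hW.indep.comp hinc hinc)
  have hr := map_increment_absolutelyContinuous hW.re.toIsPreBrownianReal n
  have hi := map_increment_absolutelyContinuous hW.im.toIsPreBrownianReal n
  exact e.absolutelyContinuous.trans (hr.prod hi)

theorem ae_forall_degeneracy_ne_zero (hW : IsComplexBrownian W P) (hm : ∀ t, Measurable (W t))
    (hc : ∀ ω, Continuous fun t ↦ W t ω)
    (hexp : ∀ ω, ExpIntegrable fun s ↦ W s.toNNReal ω) :
    ∀ᵐ ω ∂P, ∀ q : ℝ × ℝ, 0 < q.2 → degeneracy (fun j ↦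
      hermiteMoment (fun s ↦ W s.toNNReal ω) (j + 1) (q.1, q.2)) ≠ 0 := by
  have := hW.re.isGaussianProcess.isProbabilityMeasure
  choose K hK hKU using isSigmaCompact_regularSet
  have key (n m : ℕ) : ∀ᵐ ω ∂P, ∀ q ∈ K n m, degeneracy (perturbedMoment n
      (fun s ↦ complexResidual n (fun t ↦ W t ω) s.toNNReal)
      (complexIncrement n fun t ↦ W t ω) q) ≠ 0 := by
    have hKn : K n m ⊆ regularSet n := hKU n ▸ Set.subset_iUnion (K n) m
    set R : ℝ≥0 → Ω → ℂ := fun t ω ↦ complexResidual n (fun t ↦ W t ω) t with hR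
    have hRt (t : ℝ≥0) : Measurable (R t) := by
      have h1 (t : ℝ≥0) : Measurable fun ω ↦ (W t ω).re := Complex.measurable_re.comp (hm t)
      have h2 (t : ℝ≥0) : Measurable fun ω ↦ (W t ω).im := Complex.measurable_im.comp (hm t)
      exact (Complex.measurable_ofReal.comp ((h1 _).sub (Finset.measurable_fun_sum _ fun i _ ↦
        ((h1 _).sub (h1 _)).mul_const _))).add ((Complex.measurable_ofReal.comp
        ((h2 _).sub (Finset.measurable_fun_sum _ fun i _ ↦
        ((h2 _).sub (h2 _)).mul_const _))).mul_const _)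
    have hRpi : Measurable fun ω t ↦ R t ω := measurable_pi_lambda _ hRt
    -- The residual is encoded by the identity of `Ω` with the σ-algebra it generates. Continuity of
    -- its paths then gives joint measurability in time and `ω`, which evaluation on the full path
    -- space would not provide.
    let mR : MeasurableSpace Ω := MeasurableSpace.comap (fun ω t ↦ R t ω) inferInstance
    have hle : mR ≤ mΩ := hRpi.comap_le
    have hRm (t : ℝ≥0) : Measurable[mR] (R t) :=
      (measurable_pi_apply t).comp (comap_measurable fun ω t ↦ R t ω)
    have hRc (ω : Ω) : Continuous fun t ↦ R t ω := by
      have := hc ω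
      have hramp (i : Fin 3) : Continuous (realRamp n i) :=
        (continuous_ramp _ _).comp NNReal.continuous_coe
      simp only [hR, complexResidual, incrResidual]
      fun_prop
    have hRu : @Measurable _ _ (@Prod.instMeasurableSpace _ _ _ mR) _ (Function.uncurry R) :=
      measurable_uncurry_of_continuous_of_measurable hRc hRm
    have hRexp (ω : Ω) : ExpIntegrable fun s ↦ R s.toNNReal ω := (hexp ω).complexResidual n
    have hind : @IndepFun _ _ _ mΩ mR _ id (fun ω ↦ complexIncrement n fun t ↦ W t ω) P := by
      have := indepFun_complexResidual hW hm n
      rw [IndepFun_iff_Indep] at this ⊢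
      rwa [MeasurableSpace.comap_id]
    have := ae_notMem_of_indepFun (mβ := mR) (measurable_increment hm n) (measurable_id'' hle) hind
      (map_complexIncrement_absolutelyContinuous hW hm n)
      (measurableSet_exists_degeneracy_eq_zero (mΩ := mR) hRu hRexp n (hK n m) hKn)
      (fun ω ↦ measure_mono_null ?_ (volume_exists_degeneracy_eq_zero n (hRexp ω)))
    · filter_upwards [this] with ω hω q hq h0 using hω ⟨q, hq, h0⟩
    · rintro z ⟨q, hq, h0⟩
      exact ⟨q, hKn hq, h0⟩
  filter_upwards [ae_all_iff.2 fun n ↦ ae_all_iff.2 (key n)] with ω hω q hq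
  obtain ⟨n, hn⟩ := exists_rampMatrix_det_ne_zero hq
  have hmem : q ∈ regularSet n := ⟨hq, hn⟩
  rw [← hKU n] at hmem
  obtain ⟨m, hmq⟩ := Set.mem_iUnion.1 hmem
  have := hω n m q hmq
  have hpath (j : Fin 3) := hermiteMoment_path n (w := fun t ↦ W t ω) (hexp ω) hq j
  simpa only [hpath] using this

end

/-! ### Passage to a regular modification and conclusion. -/

section

variable {Ω : Type*} {mΩ : MeasurableSpace Ω} {P : Measure Ω} {W : ℝ≥0 → Ω → ℂ}

theorem IsComplexBrownian.aemeasurable (hW : IsComplexBrownian W P) (t : ℝ≥0) :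
    AEMeasurable (W t) P := by
  have h : W t = fun ω ↦ ((W t ω).re : ℂ) + (W t ω).im * Complex.I := by
    ext ω; exact (Complex.re_add_im _).symm
  rw [h]
  exact (Complex.measurable_ofReal.comp_aemeasurable (hW.re.aemeasurable t)).add
    ((Complex.measurable_ofReal.comp_aemeasurable (hW.im.aemeasurable t)).mul_const _)

theorem IsComplexBrownian.ae_continuous (hW : IsComplexBrownian W P) :
    ∀ᵐ ω ∂P, Continuous fun t ↦ W t ω := by
  filter_upwards [hW.re.cont, hW.im.cont] with ω h1 h2
  have h : (fun t ↦ W t ω) = fun t ↦ ((W t ω).re : ℂ) + (W t ω).im * Complex.I := by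
    ext t; exact (Complex.re_add_im _).symm
  rw [h]
  fun_prop

theorem IsComplexBrownian.congr (hW : IsComplexBrownian W P) {W' : ℝ≥0 → Ω → ℂ}
    (h : ∀ᵐ ω ∂P, ∀ t, W' t ω = W t ω) : IsComplexBrownian W' P where
  re :=
    { toIsPreBrownianReal := hW.re.toIsPreBrownianReal.congr fun t ↦ by
        filter_upwards [h] with ω hω using by rw [hω t]
      cont := by
        filter_upwards [h, hW.re.cont] with ω hω hc
        simpa only [hω] using hc }
  im :=
    { toIsPreBrownianReal := hW.im.toIsPreBrownianReal.congr fun t ↦ by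
        filter_upwards [h] with ω hω using by rw [hω t]
      cont := by
        filter_upwards [h, hW.im.cont] with ω hω hc
        simpa only [hω] using hc }
  indep := by
    refine hW.indep.congr ?_ ?_ <;>
    · filter_upwards [h] with ω hω
      simp only [hω]

theorem IsComplexBrownian.ae_expIntegrable (hW : IsComplexBrownian W P)
    (hm : ∀ t, Measurable (W t)) (hc : ∀ ω, Continuous fun t ↦ W t ω) :
    ∀ᵐ ω ∂P, ExpIntegrable fun s ↦ W s.toNNReal ω := by
  have hu : Measurable (Function.uncurry W) := measurable_uncurry_of_continuous_of_measurable hc hm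
  filter_upwards [ae_integrableOn_mul_exp_neg hW.re.toIsPreBrownianReal
    (Complex.measurable_re.comp hu), ae_integrableOn_mul_exp_neg hW.im.toIsPreBrownianReal
    (Complex.measurable_im.comp hu)] with ω h1 h2
  refine (h1.ofReal.add (h2.ofReal.mul_const Complex.I)).congr (.of_forall fun s ↦ ?_)
  simp only [Pi.add_apply, RCLike.ofReal_eq_complex_ofReal]
  conv_rhs => rw [← Complex.re_add_im (W s.toNNReal ω)]
  push_cast
  ring

end

theorem mainTheorem8 {Ω : Type*} {mΩ : MeasurableSpace Ω} (P : Measure Ω)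
    (W : ℝ≥0 → Ω → ℂ) (hW : IsComplexBrownian W P) :
    ∀ᵐ ω ∂P, ∀ τ₀ : ℝ≥0, 0 < τ₀ → ∀ p₀ : ℝ, 0 < p₀ →
      IsSingularity (particlePath (fun t ↦ W t ω) τ₀) p₀ →
        IsCuspSingularity (particlePath (fun t ↦ W t ω) τ₀) p₀ := by
  -- Two modifications are needed: continuity of every path gives the joint measurability behind the
  -- Fubini proof of exponential integrability, and only then can that integrability also be imposed
  -- on every path.
  obtain ⟨W₁, hm₁, hc₁, he₁⟩ := exists_measurable_modification hW.aemeasurable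
    (good := fun w ↦ Continuous w) continuous_const (fun _ h ↦ h) hW.ae_continuous
  have hW₁ := hW.congr he₁
  obtain ⟨W₂, hm₂, hg₂, he₂⟩ := exists_measurable_modification hW₁.aemeasurable
    (good := fun w ↦ Continuous w ∧ ExpIntegrable fun s ↦ w s.toNNReal)
    ⟨continuous_const, by simp [ExpIntegrable]⟩ (fun _ h ↦ h.1)
    ((hW₁.ae_expIntegrable hm₁ hc₁).mono fun ω h ↦ ⟨hc₁ ω, h⟩)
  have hW₂ := hW₁.congr he₂
  filter_upwards [he₁, he₂, ae_forall_degeneracy_ne_zero hW₂ hm₂ (fun ω ↦ (hg₂ ω).1)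
    fun ω ↦ (hg₂ ω).2] with ω h1 h2 h3 τ hτ p _ hsing
  have hpath : (fun t ↦ W t ω) = fun t ↦ W₂ t ω := by
    ext t; rw [h2, h1]
  rw [hpath] at hsing ⊢
  have hexp : ExpIntegrable fun s ↦ (fun t ↦ W₂ t ω) s.toNNReal := (hg₂ ω).2
  refine isCuspSingularity_of_linearIndependent hexp hτ hsing fun h0 ↦ ?_
  refine h3 (p, (τ : ℝ)) hτ ?_
  have hM1 := hsing.hermiteMoment_one_eq_zero hexp hτ
  simp only [degeneracy, Fin.val_zero, Fin.val_one, Fin.val_two, zero_add, Nat.reduceAdd]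
  rw [hM1, h0]
  simp
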